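/- Let $n\ge 1$, let $\bar h_R,\bar h_E\in\mathbb C^n$ be channel estimates, $\epsilon_R,\epsilon_E\ge 0$, $P>0$, with $\|\bar h_R\|>\epsilon_R$ and $\bar h_E\ne 0$. Put $\Omega_R=\{h:\|h-\bar h_R\|\le\epsilon_R\}$, $\Omega_E=\{h:\|h-\bar h_E\|\le\epsilon_E\}$ and define the maximum worst-case secrecy rate $$R_s=\max_{Q\succeq 0,\ \mathrm{Tr}\,Q\le P}\ \min_{h_R\in\Omega_R,\,h_E\in\Omega_E}\big[\log(1+h_R^\dagger Qh_R)-\log(1+h_E^\dagger Qh_E)\big].\tag{1}$$ Let $$a=P\|\bar h_E\|^2,\quad b=P\|\bar h_R\|^2,\quad c=\frac{\epsilon_R}{\|\bar h_R\|},\quad d=\frac{\epsilon_E}{\|\bar h_E\|},\quad r=\frac{|\bar h_E^\dagger\bar h_R|}{\|\bar h_R\|\|\bar h_E\|},\quad z_0=\max(c,\sqrt{1-r^2}),$$ $$g(z)=\frac{1+b(z-c)^2}{1+a\big(rz-\sqrt{1-r^2}\sqrt{1-z^2}+d\big)^2}\qquad(z_0\le z\le 1).$$ All maxima and minima in (1)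 and in (2) below are attained, and the following hold. (i) $R_s>0$ if and only if $$\text{(C1)}\quad \sqrt{1-r^2}\,z_0+\big(r-\sqrt{b/a}\big)\sqrt{1-z_0^2}\ge 0\ \text{ and }\ \sqrt{1-r^2}\sqrt{1-z_0^2}-\big(r-\sqrt{b/a}\big)z_0>c\sqrt{b/a}+d,$$ $$\text{or (C2)}\quad \sqrt{1-r^2}\,z_0+\big(r-\sqrt{b/a}\big)\sqrt{1-z_0^2}<0\ \text{ and }\ \sqrt{1-r^2+(\sqrt{b/a}-r)^2}>c\sqrt{b/a}+d.$$ Neither (C1) nor (C2) depends on $P>0$. (ii) Assume (C1) or (C2). Then $g$ has a unique maximizer $z^\star$ on $[z_0,1]$. If $0<r<1$, put $$u^\star=\sqrt{\frac{1-{z^\star}^2}{1-r^2}}\,\frac{\bar h_E}{\|\bar h_E\|}-\Big(\sqrt{\frac{1-{z^\star}^2}{1-r^2}}+\frac{z^\star}{r}\Big)\frac{(\bar h_R^\dagger\bar h_E)\,\bar h_R}{\|\bar h_R\|^2\|\bar h_E\|};$$ if $r\in\{0,1\}$ (orthogonal or collinear estimates) put $u^\star=\bar h_R/\|\bar h_R\|$.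 Then $u^\star$ solves $$\max_{\|u\|=1}\ \frac{1+P\min_{h_R\in\Omega_R}|u^\dagger h_R|^2}{1+P\max_{h_E\in\Omega_E}|u^\dagger h_E|^2},\tag{2}$$ the matrix $Q^\star=P\,u^\star{u^\star}^\dagger$ has rank one and is the one and only optimal input covariance in (1), and $R_s=\log g(z^\star)$. (iii) Let $0<r<1$ (whether or not (C1) or (C2) holds). Put $s=\sqrt{1-r^2}$, $p_0=1+bc^2$, $p_1=-4bc$, $p_2=4b+2bc^2+2$, $q_0=1+a(s+d)^2$, $q_1=4ar(s+d)$, $q_2=2-2a+6ar^2+2ad^2$, $q_3=4ar(-s+d)$, $q_4=1+a(-s+d)^2$, and $a_0=p_1q_0-p_0q_1$, $a_1=2p_2q_0-2p_0q_2$, $a_2=3p_1q_0+p_2q_1-p_1q_2-3p_0q_3$, $a_3=4p_0q_0+2p_1q_1-2p_1q_3-4q_4p_0$, $a_4=3p_0q_1+p_1q_2-p_2q_3-3q_4p_1$, $a_5=2p_0q_2-2q_4p_2$, $a_6=p_0q_3-q_4p_1$. The polynomial $a_0x^6+a_1x^5+a_2x^4+a_3x^3+a_4x^2+a_5x+a_6$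 has degree $6$, and its complex roots are, with multiplicity, the eigenvalues of the $6\times 6$ companion matrix $G$ with first row $(-a_1/a_0,\dots,-a_6/a_0)$ and lower rows $(I_5\ \ 0_{5\times 1})$. Let $x_0=(1-\sqrt{1-z_0^2})/z_0$ and let $\mathcal C\subset[x_0,1]$ consist of $x_0$ and the real eigenvalues of $G$ in $[x_0,1]$. A number $z$ maximizes $g$ on $[z_0,1]$ if and only if $z=2x/(1+x^2)$ for some $x\in\mathcal C$ that maximizes $x\mapsto g(2x/(1+x^2))$ over $\mathcal C$. -/

import Mathlib

open scoped ComplexOrder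

/-- Data of the MISO wiretap channel with `n` transmit antennas and spherical channel uncertainty:
the channel estimates `hR` (legitimate receiver) and `hE` (eavesdropper), the radii `εR` and `εE`
of the uncertainty balls, and the transmit power budget `P`. -/
structure MISOWiretap (n : ℕ) where
  hR : EuclideanSpace ℂ (Fin n)
  hE : EuclideanSpace ℂ (Fin n)
  εR : ℝ
  εE : ℝ
  P : ℝ

namespace MISOWiretap

noncomputable section

/-- The quadratic form `h† Q h` (real for Hermitian `Q`). -/
def quadForm {n : ℕ} (Q : Matrix (Fin n) (Fin n) ℂ) (h : EuclideanSpace ℂ (Fin n)) : ℝ :=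
  (star h.ofLp ⬝ᵥ Q.mulVec h.ofLp).re

/-- The secrecy rate `log (1 + hR† Q hR) - log (1 + hE† Q hE)`. -/
def secrecyRate {n : ℕ} (Q : Matrix (Fin n) (Fin n) ℂ) (kR kE : EuclideanSpace ℂ (Fin n)) : ℝ :=
  Real.log (1 + quadForm Q kR) - Real.log (1 + quadForm Q kE)

/-- The matrix `p u u†`. -/
def rankOneCov {n : ℕ} (p : ℝ) (u : EuclideanSpace ℂ (Fin n)) : Matrix (Fin n) (Fin n) ℂ :=
  (p : ℂ) • Matrix.vecMulVec u.ofLp (star u.ofLp)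

variable {n : ℕ} (W : MISOWiretap n)

/-! ### The optimization problems -/

/-- The uncertainty ball of the legitimate channel. -/
def ΩR : Set (EuclideanSpace ℂ (Fin n)) := {h | ‖h - W.hR‖ ≤ W.εR}

/-- The uncertainty ball of the eavesdropper channel. -/
def ΩE : Set (EuclideanSpace ℂ (Fin n)) := {h | ‖h - W.hE‖ ≤ W.εE}

/-- The admissible input covariance matrices: `Q ⪰ 0`, `Tr Q ≤ P`. -/
def feasible : Set (Matrix (Fin n) (Fin n) ℂ) := {Q | Q.PosSemidef ∧ Q.trace.re ≤ W.P}

/-- All secrecy rates of `Q` over the channels in the uncertainty balls. -/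
def rateSet (Q : Matrix (Fin n) (Fin n) ℂ) : Set ℝ :=
  {ρ | ∃ kR ∈ W.ΩR, ∃ kE ∈ W.ΩE, ρ = secrecyRate Q kR kE}

/-- The worst-case secrecy rate of `Q`. -/
def worstCaseRate (Q : Matrix (Fin n) (Fin n) ℂ) : ℝ := sInf (W.rateSet Q)

/-- The maximum worst-case secrecy rate `R_s`. -/
def maxRate : ℝ := sSup (W.worstCaseRate '' W.feasible)

/-- `Q` is an optimal input covariance matrix. -/
def IsOptimalCov (Q : Matrix (Fin n) (Fin n) ℂ) : Prop :=
  Q ∈ W.feasible ∧ IsMaxOn W.worstCaseRate W.feasible Q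

/-- The values `|u† h|²` over the legitimate channels `h` in the uncertainty ball. -/
def gainR (u : EuclideanSpace ℂ (Fin n)) : Set ℝ := (fun h => ‖inner ℂ u h‖ ^ 2) '' W.ΩR

/-- The values `|u† h|²` over the eavesdropper channels `h` in the uncertainty ball. -/
def gainE (u : EuclideanSpace ℂ (Fin n)) : Set ℝ := (fun h => ‖inner ℂ u h‖ ^ 2) '' W.ΩE

/-- The objective `(1 + P min |u† hR|²) / (1 + P max |u† hE|²)` of the rank-one problem. -/
def rankOneObjective (u : EuclideanSpace ℂ (Fin n)) : ℝ :=
  (1 + W.P * sInf (W.gainR u)) / (1 + W.P * sSup (W.gainE u))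

/-- `u` solves the rank-one problem: it maximizes `rankOneObjective` over the unit sphere. -/
def IsRankOneSolution (u : EuclideanSpace ℂ (Fin n)) : Prop :=
  ‖u‖ = 1 ∧ IsMaxOn W.rankOneObjective {v | ‖v‖ = 1} u

/-! ### The scalar parameters and the conditions -/

def a : ℝ := W.P * ‖W.hE‖ ^ 2

def b : ℝ := W.P * ‖W.hR‖ ^ 2

def c : ℝ := W.εR / ‖W.hR‖

def d : ℝ := W.εE / ‖W.hE‖

def r : ℝ := ‖inner ℂ W.hE W.hR‖ / (‖W.hR‖ * ‖W.hE‖)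

def z0 : ℝ := max W.c √(1 - W.r ^ 2)

def cond1 : Prop :=
  √(1 - W.r ^ 2) * W.z0 + (W.r - √(W.b / W.a)) * √(1 - W.z0 ^ 2) ≥ 0 ∧
  √(1 - W.r ^ 2) * √(1 - W.z0 ^ 2) - (W.r - √(W.b / W.a)) * W.z0 > W.c * √(W.b / W.a) + W.d

def cond2 : Prop :=
  √(1 - W.r ^ 2) * W.z0 + (W.r - √(W.b / W.a)) * √(1 - W.z0 ^ 2) < 0 ∧
  √(1 - W.r ^ 2 + (√(W.b / W.a) - W.r) ^ 2) > W.c * √(W.b / W.a) + W.d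

/-- The scalar objective function `g`. -/
def g (z : ℝ) : ℝ :=
  (1 + W.b * (z - W.c) ^ 2) /
    (1 + W.a * (W.r * z - √(1 - W.r ^ 2) * √(1 - z ^ 2) + W.d) ^ 2)

/-- `z` maximizes `g` on `[z0, 1]`. -/
def IsMaximizer (z : ℝ) : Prop := z ∈ Set.Icc W.z0 1 ∧ IsMaxOn W.g (Set.Icc W.z0 1) z

open Classical in
/-- The optimal direction attached to `z`. For `0 < r < 1` it is the explicit linear combination of
the two channel estimates; for `r = 0` (orthogonal estimates) and `r = 1` (collinear estimates)
that expression reads `0 / 0`, and the direction is that of `hR`. -/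
def uStar (z : ℝ) : EuclideanSpace ℂ (Fin n) :=
  if 0 < W.r ∧ W.r < 1 then
    ((√((1 - z ^ 2) / (1 - W.r ^ 2)) / ‖W.hE‖ : ℝ) : ℂ) • W.hE -
      (((√((1 - z ^ 2) / (1 - W.r ^ 2)) + z / W.r : ℝ) : ℂ) *
        (inner ℂ W.hR W.hE / ((‖W.hR‖ ^ 2 * ‖W.hE‖ : ℝ) : ℂ))) • W.hR
  else ((1 / ‖W.hR‖ : ℝ) : ℂ) • W.hR

/-! ### The polynomial of degree six and its companion matrix -/

def p0 : ℝ := 1 + W.b * W.c ^ 2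
def p1 : ℝ := -4 * W.b * W.c
def p2 : ℝ := 4 * W.b + 2 * W.b * W.c ^ 2 + 2
def q0 : ℝ := 1 + W.a * (√(1 - W.r ^ 2) + W.d) ^ 2
def q1 : ℝ := 4 * W.a * W.r * (√(1 - W.r ^ 2) + W.d)
def q2 : ℝ := 2 - 2 * W.a + 6 * W.a * W.r ^ 2 + 2 * W.a * W.d ^ 2
def q3 : ℝ := 4 * W.a * W.r * (-√(1 - W.r ^ 2) + W.d)
def q4 : ℝ := 1 + W.a * (-√(1 - W.r ^ 2) + W.d) ^ 2

def a0 : ℝ := W.p1 * W.q0 - W.p0 * W.q1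
def a1 : ℝ := 2 * W.p2 * W.q0 - 2 * W.p0 * W.q2
def a2 : ℝ := 3 * W.p1 * W.q0 + W.p2 * W.q1 - W.p1 * W.q2 - 3 * W.p0 * W.q3
def a3 : ℝ := 4 * W.p0 * W.q0 + 2 * W.p1 * W.q1 - 2 * W.p1 * W.q3 - 4 * W.q4 * W.p0
def a4 : ℝ := 3 * W.p0 * W.q1 + W.p1 * W.q2 - W.p2 * W.q3 - 3 * W.q4 * W.p1
def a5 : ℝ := 2 * W.p0 * W.q2 - 2 * W.q4 * W.p2
def a6 : ℝ := W.p0 * W.q3 - W.q4 * W.p1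

open Polynomial in
/-- The polynomial `a0 x⁶ + a1 x⁵ + ⋯ + a6` with real coefficients. -/
def sextic : ℝ[X] :=
  C W.a0 * X ^ 6 + C W.a1 * X ^ 5 + C W.a2 * X ^ 4 + C W.a3 * X ^ 3 + C W.a4 * X ^ 2 +
    C W.a5 * X + C W.a6

/-- The companion matrix of the polynomial of degree six. -/
def G : Matrix (Fin 6) (Fin 6) ℝ :=
  !![-(W.a1 / W.a0), -(W.a2 / W.a0), -(W.a3 / W.a0), -(W.a4 / W.a0), -(W.a5 / W.a0), -(W.a6 / W.a0);
     1, 0, 0, 0, 0, 0;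
     0, 1, 0, 0, 0, 0;
     0, 0, 1, 0, 0, 0;
     0, 0, 0, 1, 0, 0;
     0, 0, 0, 0, 1, 0]

/-- The matrix `G` over the complex numbers. -/
def GC : Matrix (Fin 6) (Fin 6) ℂ := W.G.map (fun x : ℝ => (x : ℂ))

/-- The boundary point in the variable `x`. -/
def x0 : ℝ := (1 - √(1 - W.z0 ^ 2)) / W.z0

/-- The bijection `x ↦ 2 x / (1 + x²)` of `[0, 1]`. -/
def zOf (x : ℝ) : ℝ := 2 * x / (1 + x ^ 2)

/-- The candidates: the boundary point and the eigenvalues of `G` lying in `[x0, 1]`. -/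
def candidates : Set ℝ :=
  {x | x ∈ Set.Icc W.x0 1 ∧
    (x = W.x0 ∨ Module.End.HasEigenvalue (Matrix.toLin' W.GC) (x : ℂ))}

end

end MISOWiretap

/-!
The worst channels in the two balls are explicit for a covariance `P u u†` with `‖u‖ = 1`: over the
balls, the minimum of `|u† k|²` is `(|u† hR| - εR)²` (if `|u† hR| ≥ εR`) and the maximum is
`(|u† hE| + εE)²`. With `z` the normalized correlation of `u` with the estimate `hR`, the smallest
possible correlation with `hE` is `r z - s √(1 - z²)`, `s = √(1 - r²)`, as long as `z ≥ s`; this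
leads to the scalar function `g`.

Optimality among all covariance matrices is a saddle point argument. Let `z` maximize `g` with
`lam = g z > 1`, and fix the channels `kR`, `kE` that are worst for the direction `u` of `z`. The
first-order condition at `z` says that `u` is a null vector of the Hermitian form
`(lam - 1) ‖x‖² + lam P |kE† x|² - P |kR† x|²`. For `lam > 1` this is a positive definite form minus
a single square, so the existence of a null vector makes it positive semidefinite with a
one-dimensional kernel (`certificate_vector`). Summed over a decomposition `Q = ∑ x x†` this gives
`1 + kR† Q kR ≤ lam (1 + kE† Q kE)` for every feasible `Q`, with equality for `Q = P u u†` only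
(`worstCaseRate_of_certificate`). In particular the optimal covariance is unique, and the
uniqueness of the maximizer of `g` is read off from it. At the boundary point `z = s`, where `u` is
orthogonal to `hE`, the derivative of `g` need not vanish; there `kE` is replaced by a mixture of
the two equally bad channels `hE ± εE u` (`IsMaximizer.exists_weight`).

The conditions for a positive rate say that the distance of `hR` from the set of points `t hE`,
`|t| ≤ 1`, exceeds `εR + εE` (`cond_iff`). If it does not, the ball of the receiver meets the convex
hull of the phase rotations of the ball of the eavesdropper, and convexity of `h ↦ h† Q h` makes
every worst-case rate nonpositive (`worstCaseRate_nonpos`). If it does, `g` exceeds `1` somewhere.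

In the coordinate `z = 2x / (1 + x²)` the function `g` is a quotient of two quartics, and the sextic
is the numerator of its derivative (`eval_sextic_eq`). The end point `z = 1` is never a maximizer
for `0 < r < 1`, so every maximizer is the boundary point or an eigenvalue of the companion matrix.
-/

namespace MISOWiretap

/-! ### Quadratic forms of covariance matrices -/

section QuadForm

variable {n : ℕ}

theorem quadForm_rankOneCov (p : ℝ) (u h : EuclideanSpace ℂ (Fin n)) :
    quadForm (rankOneCov p u) h = p * ‖inner ℂ u h‖ ^ 2 := by
  have h1 : inner ℂ u h = star u.ofLp ⬝ᵥ h.ofLp := by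
    rw [EuclideanSpace.inner_eq_star_dotProduct, dotProduct_comm]
  have h2 : star h.ofLp ⬝ᵥ u.ofLp = star (inner ℂ u h) := by
    rw [h1, Matrix.star_dotProduct]
  rw [quadForm, rankOneCov, Matrix.smul_mulVec, dotProduct_smul, Matrix.vecMulVec_mulVec,
    dotProduct_smul, ← h1, h2]
  have h3 : star (inner ℂ u h) * inner ℂ u h = ((‖inner ℂ u h‖ ^ 2 : ℝ) : ℂ) := by
    rw [Complex.star_def, Complex.conj_mul']
    push_cast
    rfl
  simp only [smul_eq_mul, MulOpposite.smul_eq_mul_unop, MulOpposite.unop_op, h3]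
  rw [← Complex.ofReal_mul, Complex.ofReal_re]

theorem trace_rankOneCov (p : ℝ) (u : EuclideanSpace ℂ (Fin n)) :
    (rankOneCov p u).trace = ((p * ‖u‖ ^ 2 : ℝ) : ℂ) := by
  have h1 : u.ofLp ⬝ᵥ star u.ofLp = ((‖u‖ ^ 2 : ℝ) : ℂ) := by
    rw [← EuclideanSpace.inner_eq_star_dotProduct, inner_self_eq_norm_sq_to_K]
    simp
  rw [rankOneCov, Matrix.trace_smul, Matrix.trace_vecMulVec, h1]
  simp

theorem posSemidef_rankOneCov {p : ℝ} (hp : 0 ≤ p) (u : EuclideanSpace ℂ (Fin n)) :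
    (rankOneCov p u).PosSemidef :=
  (Matrix.posSemidef_vecMulVec_self_star u.ofLp).smul (by exact_mod_cast hp)

theorem rankOneCov_smul (p : ℝ) (t : ℂ) (u : EuclideanSpace ℂ (Fin n)) :
    rankOneCov p (t • u) = rankOneCov (p * ‖t‖ ^ 2) u := by
  ext i j
  simp only [rankOneCov, Matrix.smul_apply, Matrix.vecMulVec_apply, Pi.star_apply, PiLp.smul_apply,
    smul_eq_mul, star_mul', Complex.ofReal_mul, Complex.ofReal_pow, ← Complex.conj_mul',
    Complex.star_def]
  ring

theorem rankOneCov_sum {ι : Type*} (s : Finset ι) (p : ι → ℝ) (u : EuclideanSpace ℂ (Fin n)) :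
    ∑ i ∈ s, rankOneCov (p i) u = rankOneCov (∑ i ∈ s, p i) u := by
  simp [rankOneCov, Finset.sum_smul]

theorem rank_rankOneCov {p : ℝ} (hp : p ≠ 0) {u : EuclideanSpace ℂ (Fin n)} (hu : u ≠ 0) :
    (rankOneCov p u).rank = 1 := by
  have hle : (rankOneCov p u).rank ≤ 1 := by
    rw [rankOneCov, ← Matrix.smul_vecMulVec]
    exact Matrix.rank_vecMulVec_le _ _
  have hne : (rankOneCov p u).rank ≠ 0 := by
    intro h0
    rw [Matrix.rank, Submodule.finrank_eq_zero, LinearMap.range_eq_bot,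
      ← Matrix.toLin'_apply', LinearEquiv.map_eq_zero_iff] at h0
    have := trace_rankOneCov p u
    rw [h0, Matrix.trace_zero] at this
    have h2 : p * ‖u‖ ^ 2 = 0 := by exact_mod_cast this.symm
    simp [hp, hu] at h2
  omega

theorem quadForm_sum {ι : Type*} (s : Finset ι) (Q : ι → Matrix (Fin n) (Fin n) ℂ)
    (h : EuclideanSpace ℂ (Fin n)) :
    quadForm (∑ i ∈ s, Q i) h = ∑ i ∈ s, quadForm (Q i) h := by
  simp [quadForm, Matrix.sum_mulVec, dotProduct_sum]

/-- A positive semidefinite matrix is a sum of matrices `x x†`; the vectors `x` are the conjugated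
rows of a matrix `B` with `Q = B† B`. -/
theorem exists_eq_sum_rankOneCov {Q : Matrix (Fin n) (Fin n) ℂ} (hQ : Q.PosSemidef) :
    ∃ x : Fin n → EuclideanSpace ℂ (Fin n), Q = ∑ i, rankOneCov 1 (x i) := by
  obtain ⟨B, rfl⟩ : ∃ B : Matrix (Fin n) (Fin n) ℂ, Q = B.conjTranspose * B := by
    open scoped MatrixOrder in
    obtain ⟨B, hB, -, rfl⟩ :=
      CFC.exists_sqrt_of_isSelfAdjoint_of_quasispectrumRestricts hQ.isHermitian
        (QuasispectrumRestricts.nnreal_of_nonneg hQ.nonneg)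
    exact ⟨B, by rw [← Matrix.star_eq_conjTranspose, hB.star_eq]⟩
  refine ⟨fun i => WithLp.toLp 2 (star (B i)), ?_⟩
  ext k l
  simp [Matrix.mul_apply, Matrix.sum_apply, rankOneCov, Matrix.vecMulVec_apply]

theorem quadForm_nonneg {Q : Matrix (Fin n) (Fin n) ℂ} (hQ : Q.PosSemidef)
    (h : EuclideanSpace ℂ (Fin n)) : 0 ≤ quadForm Q h := by
  obtain ⟨x, rfl⟩ := exists_eq_sum_rankOneCov hQ
  rw [quadForm_sum]
  refine Finset.sum_nonneg fun i _ => ?_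
  rw [quadForm_rankOneCov]
  positivity

theorem quadForm_smul_of_norm_eq_one (Q : Matrix (Fin n) (Fin n) ℂ)
    (h : EuclideanSpace ℂ (Fin n)) {ω : ℂ} (hω : ‖ω‖ = 1) :
    quadForm Q (ω • h) = quadForm Q h := by
  have : ω * star ω = 1 := by
    rw [mul_comm, Complex.star_def, Complex.conj_mul', hω]
    simp
  simp only [quadForm, WithLp.ofLp_smul, star_smul, smul_dotProduct, Matrix.mulVec_smul,
    dotProduct_smul, smul_smul, this, one_smul]

/-- Convexity of `h ↦ h† Q h`, in the form of a bound by the larger of two values. -/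
theorem quadForm_convexCombo_le {Q : Matrix (Fin n) (Fin n) ℂ} (hQ : Q.PosSemidef)
    (x y : EuclideanSpace ℂ (Fin n)) {α β : ℝ} (hα : 0 ≤ α) (hβ : 0 ≤ β) (hαβ : α + β = 1) :
    quadForm Q (α • x + β • y) ≤ α * quadForm Q x + β * quadForm Q y := by
  obtain ⟨v, rfl⟩ := exists_eq_sum_rankOneCov hQ
  simp only [quadForm_sum, Finset.mul_sum, ← Finset.sum_add_distrib]
  refine Finset.sum_le_sum fun i _ => ?_
  simp only [quadForm_rankOneCov, one_mul]
  have h1 : ‖inner ℂ (v i) (α • x + β • y)‖ ≤ α * ‖inner ℂ (v i) x‖ + β * ‖inner ℂ (v i) y‖ := by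
    rw [inner_add_right, inner_smul_right_eq_smul, inner_smul_right_eq_smul]
    refine (norm_add_le _ _).trans (le_of_eq ?_)
    rw [norm_smul, norm_smul, Real.norm_of_nonneg hα, Real.norm_of_nonneg hβ]
  refine (pow_le_pow_left₀ (norm_nonneg _) h1 2).trans ?_
  obtain rfl : β = 1 - α := by linarith
  nlinarith [mul_nonneg (mul_nonneg hα hβ)
    (sq_nonneg (‖inner ℂ (v i) x‖ - ‖inner ℂ (v i) y‖))]

theorem continuous_quadForm (Q : Matrix (Fin n) (Fin n) ℂ) : Continuous (quadForm Q) := by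
  unfold quadForm
  fun_prop

end QuadForm

/-! ### The minima and maxima over the uncertainty balls are attained -/

section Attained

variable {n : ℕ} (W : MISOWiretap n)

theorem isCompact_ΩR : IsCompact W.ΩR := by
  have : W.ΩR = Metric.closedBall W.hR W.εR := by
    ext h
    simp [ΩR, dist_eq_norm]
  rw [this]
  exact isCompact_closedBall _ _

theorem isCompact_ΩE : IsCompact W.ΩE := by
  have : W.ΩE = Metric.closedBall W.hE W.εE := by
    ext h
    simp [ΩE, dist_eq_norm]
  rw [this]
  exact isCompact_closedBall _ _

variable {W}

theorem hR_mem_ΩR (hεR : 0 ≤ W.εR) : W.hR ∈ W.ΩR := by simpa [ΩR] using hεR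

theorem hE_mem_ΩE (hεE : 0 ≤ W.εE) : W.hE ∈ W.ΩE := by simpa [ΩE] using hεE

theorem isLeast_gainR (hεR : 0 ≤ W.εR) (u : EuclideanSpace ℂ (Fin n)) :
    IsLeast (W.gainR u) (sInf (W.gainR u)) :=
  (W.isCompact_ΩR.image (by fun_prop)).isLeast_sInf ⟨_, _, hR_mem_ΩR hεR, rfl⟩

theorem isGreatest_gainE (hεE : 0 ≤ W.εE) (u : EuclideanSpace ℂ (Fin n)) :
    IsGreatest (W.gainE u) (sSup (W.gainE u)) :=
  (W.isCompact_ΩE.image (by fun_prop)).isGreatest_sSup ⟨_, _, hE_mem_ΩE hεE, rfl⟩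

theorem isLeast_rateSet (hεR : 0 ≤ W.εR) (hεE : 0 ≤ W.εE) {Q : Matrix (Fin n) (Fin n) ℂ}
    (hQ : Q.PosSemidef) : IsLeast (W.rateSet Q) (W.worstCaseRate Q) := by
  have heq : W.rateSet Q = (fun k : _ × _ => secrecyRate Q k.1 k.2) '' (W.ΩR ×ˢ W.ΩE) := by
    ext ρ
    constructor
    · rintro ⟨kR, hkR, kE, hkE, rfl⟩
      exact ⟨(kR, kE), ⟨hkR, hkE⟩, rfl⟩
    · rintro ⟨⟨kR, kE⟩, ⟨hkR, hkE⟩, rfl⟩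
      exact ⟨kR, hkR, kE, hkE, rfl⟩
  have hc := continuous_quadForm Q
  have hpos : ∀ h, 1 + quadForm Q h ≠ 0 := fun h => by
    have := quadForm_nonneg hQ h
    positivity
  have hcont : Continuous fun k : EuclideanSpace ℂ (Fin n) × EuclideanSpace ℂ (Fin n) =>
      secrecyRate Q k.1 k.2 := by
    unfold secrecyRate
    exact ((continuous_const.add (hc.comp continuous_fst)).log fun k => hpos _).sub
      ((continuous_const.add (hc.comp continuous_snd)).log fun k => hpos _)
  have hcomp : IsCompact (W.rateSet Q) := by
    rw [heq]
    exact (W.isCompact_ΩR.prod W.isCompact_ΩE).image hcont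
  exact hcomp.isLeast_sInf ⟨_, _, hR_mem_ΩR hεR, _, hE_mem_ΩE hεE, rfl⟩

/-- The worst-case rate of `P u u†` is the logarithm of the objective of the rank-one problem. -/
theorem worstCaseRate_rankOneCov (hεR : 0 ≤ W.εR) (hεE : 0 ≤ W.εE) (hP : 0 < W.P)
    (u : EuclideanSpace ℂ (Fin n)) :
    W.worstCaseRate (rankOneCov W.P u) = Real.log (W.rankOneObjective u) ∧
      0 < W.rankOneObjective u := by
  obtain ⟨⟨kR, hkR, hkR'⟩, hlow⟩ := isLeast_gainR hεR u
  obtain ⟨⟨kE, hkE, hkE'⟩, hupp⟩ := isGreatest_gainE hεE u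
  have hR0 : 0 ≤ sInf (W.gainR u) := by rw [← hkR']; positivity
  have hE0 : 0 ≤ sSup (W.gainE u) := by rw [← hkE']; positivity
  have hR1 : 0 < 1 + W.P * sInf (W.gainR u) := by positivity
  have hE1 : 0 < 1 + W.P * sSup (W.gainE u) := by positivity
  refine ⟨IsLeast.unique (isLeast_rateSet hεR hεE (posSemidef_rankOneCov hP.le u)) ⟨?_, ?_⟩,
    div_pos hR1 hE1⟩
  · refine ⟨kR, hkR, kE, hkE, ?_⟩
    rw [rankOneObjective, Real.log_div hR1.ne' hE1.ne', secrecyRate, quadForm_rankOneCov,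
      quadForm_rankOneCov, ← hkR', ← hkE']
  · rintro ρ ⟨lR, hlR, lE, hlE, rfl⟩
    rw [rankOneObjective, Real.log_div hR1.ne' hE1.ne', secrecyRate, quadForm_rankOneCov,
      quadForm_rankOneCov]
    have h1 := hlow ⟨lR, hlR, rfl⟩
    have h2 := hupp ⟨lE, hlE, rfl⟩
    simp only at h1 h2
    gcongr

end Attained

/-! ### The saddle point certificate -/

section Certificate

/-- The channel pair that is worst for the unit vector `u` certifies `u`. In the application `fR`
and `fE` are the channel estimates, rotated by phases so that `Z = u† fR` and `w = u† fE` are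
nonnegative reals. For `lam > 1` the
Hermitian form
`(lam - 1) ‖x‖² + lam P (mixture of |⟪fE ± eE u, x⟫|²) - P |⟪fR - eR u, x⟫|²`
is a positive definite form minus one square, and `hvec`, `hval` say that `u` is a null vector of
it. Hence it does not change when a multiple of `u` is subtracted from `x`; subtracting the multiple
that makes the last square vanish gives the bound. The mixture with weights `(1 ± κ) / 2` is only
needed when `w = 0`, where all the channels `fE + eE ω u` with `|ω| = 1` are equally bad and no
single one of them certifies `u`. -/
theorem certificate_vector {E : Type*} [NormedAddCommGroup E] [InnerProductSpace ℂ E]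
    {u fR fE : E} {P lam κ eR eE Z w : ℝ} (hu : ‖u‖ = 1) (hP : 0 ≤ P) (hlam : 0 ≤ lam)
    (hκ0 : 0 ≤ κ) (hκ1 : κ ≤ 1) (hκw : κ * w = w) (hZ : eR < Z)
    (hval : 1 + P * (Z - eR) ^ 2 = lam * (1 + P * (w + eE) ^ 2))
    (hvec : (Z - eR) • (fR - Z • u) = (lam * (w + κ * eE)) • (fE - w • u)) (x : E) :
    ∃ t : ℂ, P * ‖inner ℂ x (fR - eR • u)‖ ^ 2 + (lam - 1) * ‖x - t • u‖ ^ 2 ≤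
      (lam - 1) * ‖x‖ ^ 2 + lam * P * ((1 + κ) / 2 * ‖inner ℂ x (fE + eE • u)‖ ^ 2 +
        (1 - κ) / 2 * ‖inner ℂ x (fE - eE • u)‖ ^ 2) := by
  have hZ' : Z - eR ≠ 0 := by linarith
  obtain ⟨t, ht⟩ : ∃ t : ℂ, inner ℂ (fR - eR • u) x = (Z - eR : ℝ) • t :=
    ⟨(Z - eR : ℝ)⁻¹ • inner ℂ (fR - eR • u) x, by rw [smul_inv_smul₀ hZ']⟩
  refine ⟨t, ?_⟩
  have hv := congrArg (fun y => inner ℂ y x) hvec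
  simp only [inner_sub_left, inner_smul_left_eq_smul] at hv ht
  have hnorm : ‖x - t • u‖ ^ 2 = ‖x‖ ^ 2 - 2 * (t * inner ℂ x u).re + ‖t‖ ^ 2 := by
    rw [@norm_sub_sq ℂ, inner_smul_right, norm_smul, hu, mul_one]
    rfl
  have hpos : 0 ≤ lam * P * ((1 + κ) / 2 * ‖inner ℂ fE x + eE • inner ℂ u x - (w + eE) • t‖ ^ 2 +
      (1 - κ) / 2 * ‖inner ℂ fE x - eE • inner ℂ u x - (w - eE) • t‖ ^ 2) := by
    have : 0 ≤ 1 - κ := by linarith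
    positivity
  rw [norm_inner_symm x, norm_inner_symm x, norm_inner_symm x, hnorm, ← inner_conj_symm x u]
  simp only [inner_sub_left, inner_add_left, inner_smul_left_eq_smul]
  generalize inner ℂ u x = U at *
  generalize inner ℂ fE x = F at *
  generalize inner ℂ fR x = R at *
  obtain ⟨hv1, hv2⟩ := Complex.ext_iff.1 hv
  obtain ⟨ht1, ht2⟩ := Complex.ext_iff.1 ht
  simp only [Complex.sq_norm, Complex.normSq_apply, Complex.sub_re, Complex.sub_im, Complex.add_re,
    Complex.add_im, Complex.smul_re, Complex.smul_im, smul_eq_mul, Complex.mul_re,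
    Complex.conj_re, Complex.conj_im] at *
  refine le_of_sub_nonneg (hpos.trans_eq ?_)
  linear_combination P * (R.re - eR * U.re - (Z - eR) * t.re) * ht1 + 2 * P * t.re * hv1 -
      (t.re ^ 2 - 2 * t.re * U.re) * hval -
      (4 * lam * P * eE * t.re * U.re - 2 * lam * P * eE * t.re ^ 2) * hκw +
    P * (R.im - eR * U.im - (Z - eR) * t.im) * ht2 + 2 * P * t.im * hv2 -
      (t.im ^ 2 - 2 * t.im * U.im) * hval -
      (4 * lam * P * eE * t.im * U.im - 2 * lam * P * eE * t.im ^ 2) * hκw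

variable {n : ℕ}

/-- For the worst channels of `u` no covariance matrix beats `P u u†`, and only this one attains the
ratio `lam`. -/
theorem eq_rankOneCov_of_certificate
    {u fR fE : EuclideanSpace ℂ (Fin n)} {P lam κ eR eE Z w : ℝ} (hu : ‖u‖ = 1) (hP : 0 ≤ P)
    (hlam : 1 < lam) (hκ0 : 0 ≤ κ) (hκ1 : κ ≤ 1) (hκw : κ * w = w) (hZ : eR < Z)
    (hval : 1 + P * (Z - eR) ^ 2 = lam * (1 + P * (w + eE) ^ 2))
    (hvec : (Z - eR) • (fR - Z • u) = (lam * (w + κ * eE)) • (fE - w • u))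
    {Q : Matrix (Fin n) (Fin n) ℂ} (hQ : Q.PosSemidef) (hQP : Q.trace.re ≤ P)
    (hplus : lam * (1 + quadForm Q (fE + eE • u)) ≤ 1 + quadForm Q (fR - eR • u))
    (hminus : lam * (1 + quadForm Q (fE - eE • u)) ≤ 1 + quadForm Q (fR - eR • u)) :
    Q = rankOneCov P u := by
  obtain ⟨x, rfl⟩ := exists_eq_sum_rankOneCov hQ
  choose t ht using fun i => certificate_vector hu hP (zero_le_one.trans hlam.le) hκ0 hκ1 hκw hZ
    hval hvec (x i)
  have hsum := Finset.sum_le_sum fun i (_ : i ∈ Finset.univ) => ht i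
  simp only [quadForm_sum, quadForm_rankOneCov, one_mul] at hplus hminus
  simp only [Finset.sum_add_distrib, ← Finset.mul_sum] at hsum
  have htr : (∑ i, rankOneCov 1 (x i)).trace.re = ∑ i, ‖x i‖ ^ 2 := by
    simp only [Matrix.trace_sum, trace_rankOneCov, Complex.re_sum, Complex.ofReal_re, one_mul]
  rw [htr] at hQP
  set A := ∑ i, ‖inner ℂ (x i) (fR - eR • u)‖ ^ 2
  set B := ∑ i, ‖inner ℂ (x i) (fE + eE • u)‖ ^ 2
  set C := ∑ i, ‖inner ℂ (x i) (fE - eE • u)‖ ^ 2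
  set D := ∑ i, ‖x i - t i • u‖ ^ 2 with hD
  set T := ∑ i, ‖x i‖ ^ 2 with hT
  have hD0 : 0 ≤ D := Finset.sum_nonneg fun i _ => by positivity
  have hmix : lam + lam * ((1 + κ) / 2 * B + (1 - κ) / 2 * C) ≤ 1 + A := by
    have h1 := mul_le_mul_of_nonneg_left hplus (show 0 ≤ (1 + κ) / 2 by linarith)
    have h2 := mul_le_mul_of_nonneg_left hminus (show 0 ≤ (1 - κ) / 2 by linarith)
    linarith
  have h3 := mul_le_mul_of_nonneg_left hmix hP
  have h4 : (lam - 1) * (D + (P - T)) ≤ 0 := by linarith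
  have h5 : D + (P - T) ≤ 0 := by
    by_contra! h
    exact absurd h4 (mul_pos (sub_pos.2 hlam) h).not_ge
  have hD' : D = 0 := by linarith
  have hTP : T = P := by linarith
  have hx : ∀ i, x i = t i • u := fun i => by
    have := (Finset.sum_eq_zero_iff_of_nonneg fun i _ => by positivity).1 (hD.symm.trans hD') i
      (Finset.mem_univ i)
    rwa [sq_eq_zero_iff, norm_eq_zero, sub_eq_zero] at this
  have hsumt : ∑ i, 1 * ‖t i‖ ^ 2 = P := by
    rw [← hTP, hT]
    refine Finset.sum_congr rfl fun i _ => ?_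
    rw [hx i, norm_smul, hu, mul_one, one_mul]
  rw [← hsumt, ← rankOneCov_sum]
  refine Finset.sum_congr rfl fun i _ => ?_
  rw [hx i, rankOneCov_smul]

end Certificate

section Saddle

variable {n : ℕ} {W : MISOWiretap n}

/-- If `u` and its worst channels satisfy the conditions of the certificate, then `P u u†` is the
unique optimal covariance matrix, with rate `log lam`. -/
theorem worstCaseRate_of_certificate (hεR : 0 ≤ W.εR) (hεE : 0 ≤ W.εE) (hP : 0 < W.P)
    {u : EuclideanSpace ℂ (Fin n)} {μ ν : ℂ} {lam κ Z w : ℝ}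
    (hu : ‖u‖ = 1) (hμ : ‖μ‖ = 1) (hν : ‖ν‖ = 1)
    (hlam : 1 < lam) (hκ0 : 0 ≤ κ) (hκ1 : κ ≤ 1) (hκw : κ * w = w) (hw : 0 ≤ w) (hZ : W.εR < Z)
    (hR : inner ℂ u (μ • W.hR) = (Z : ℂ)) (hE : inner ℂ u (ν • W.hE) = (w : ℂ))
    (hval : 1 + W.P * (Z - W.εR) ^ 2 = lam * (1 + W.P * (w + W.εE) ^ 2))
    (hvec : (Z - W.εR) • (μ • W.hR - Z • u) = (lam * (w + κ * W.εE)) • (ν • W.hE - w • u)) :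
    W.worstCaseRate (rankOneCov W.P u) = Real.log lam ∧
      ∀ Q ∈ W.feasible, Real.log lam ≤ W.worstCaseRate Q → Q = rankOneCov W.P u := by
  have hrot : ∀ (ω : ℂ) (e : ℝ) (h : EuclideanSpace ℂ (Fin n)), ‖ω‖ = 1 →
      ‖ω⁻¹ • (ω • h + e • u) - h‖ = |e| := by
    intro ω e h hω
    have hω0 : ω ≠ 0 := by rintro rfl; simp at hω
    rw [smul_add, inv_smul_smul₀ hω0, add_sub_cancel_left, norm_smul, norm_smul, norm_inv, hω, hu]
    simp
  have hinv : ∀ ω : ℂ, ‖ω‖ = 1 → ‖ω⁻¹‖ = 1 := fun ω hω => by rw [norm_inv, hω, inv_one]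
  have hkR : μ⁻¹ • (μ • W.hR - W.εR • u) ∈ W.ΩR := by
    have := hrot μ (-W.εR) W.hR hμ
    rw [neg_smul, ← sub_eq_add_neg, abs_neg, abs_of_nonneg hεR] at this
    exact this.le
  have hkE : ν⁻¹ • (ν • W.hE + W.εE • u) ∈ W.ΩE := by
    have := hrot ν W.εE W.hE hν
    rw [abs_of_nonneg hεE] at this
    exact this.le
  have hkE' : ν⁻¹ • (ν • W.hE - W.εE • u) ∈ W.ΩE := by
    have := hrot ν (-W.εE) W.hE hν
    rw [neg_smul, ← sub_eq_add_neg, abs_neg, abs_of_nonneg hεE] at this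
    exact this.le
  have huu : inner ℂ u u = (1 : ℂ) := by rw [inner_self_eq_norm_sq_to_K, hu]; simp
  have hlam0 : 0 < lam := by linarith
  constructor
  · refine IsLeast.unique (isLeast_rateSet hεR hεE (posSemidef_rankOneCov hP.le u)) ⟨?_, ?_⟩
    · refine ⟨_, hkR, _, hkE, ?_⟩
      have h1 : inner ℂ u (μ • W.hR - W.εR • u) = ((Z - W.εR : ℝ) : ℂ) := by
        rw [inner_sub_right, hR, inner_smul_right_eq_smul, huu]; simp
      have h2 : inner ℂ u (ν • W.hE + W.εE • u) = ((w + W.εE : ℝ) : ℂ) := by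
        rw [inner_add_right, hE, inner_smul_right_eq_smul, huu]; simp
      rw [secrecyRate, quadForm_smul_of_norm_eq_one _ _ (hinv μ hμ),
        quadForm_smul_of_norm_eq_one _ _ (hinv ν hν), quadForm_rankOneCov, quadForm_rankOneCov,
        h1, h2, Complex.norm_real, Complex.norm_real, Real.norm_eq_abs, Real.norm_eq_abs, sq_abs,
        sq_abs, hval, Real.log_mul hlam0.ne' (by positivity)]
      ring
    · rintro ρ ⟨kR, hkR, kE, hkE, rfl⟩
      have hZn : ‖inner ℂ u W.hR‖ = Z := by
        have := congrArg norm hR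
        rwa [inner_smul_right, norm_mul, hμ, one_mul, Complex.norm_real,
          Real.norm_of_nonneg (hεR.trans hZ.le)] at this
      have hwn : ‖inner ℂ u W.hE‖ = w := by
        have := congrArg norm hE
        rwa [inner_smul_right, norm_mul, hν, one_mul, Complex.norm_real,
          Real.norm_of_nonneg hw] at this
      have h1 : Z - W.εR ≤ ‖inner ℂ u kR‖ := by
        have h := (norm_inner_le_norm (𝕜 := ℂ) u (kR - W.hR)).trans
          (mul_le_mul_of_nonneg_left hkR (norm_nonneg u))
        rw [inner_sub_right, hu, one_mul] at h
        have h' := norm_sub_norm_le (inner ℂ u W.hR) (inner ℂ u kR)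
        rw [norm_sub_rev] at h'
        linarith
      have h2 : ‖inner ℂ u kE‖ ≤ w + W.εE := by
        have h := (norm_inner_le_norm (𝕜 := ℂ) u (kE - W.hE)).trans
          (mul_le_mul_of_nonneg_left hkE (norm_nonneg u))
        rw [inner_sub_right, hu, one_mul] at h
        have h' := norm_sub_norm_le (inner ℂ u kE) (inner ℂ u W.hE)
        linarith
      have hZ' : 0 ≤ Z - W.εR := by linarith
      have h3 : Real.log lam = Real.log (1 + W.P * (Z - W.εR) ^ 2) -
          Real.log (1 + W.P * (w + W.εE) ^ 2) := by
        rw [hval, Real.log_mul hlam0.ne' (by positivity)]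
        ring
      rw [h3, secrecyRate, quadForm_rankOneCov, quadForm_rankOneCov]
      gcongr
  · rintro Q ⟨hQ, hQP⟩ hrate
    have key : ∀ kR ∈ W.ΩR, ∀ kE ∈ W.ΩE, lam * (1 + quadForm Q kE) ≤ 1 + quadForm Q kR := by
      intro kR hkR kE hkE
      have h1 := hrate.trans ((isLeast_rateSet hεR hεE hQ).2 ⟨kR, hkR, kE, hkE, rfl⟩)
      have hR0 := quadForm_nonneg hQ kR
      have hE0 := quadForm_nonneg hQ kE
      rw [secrecyRate, le_sub_iff_add_le, ← Real.log_mul (by positivity) (by positivity)] at h1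
      exact (Real.log_le_log_iff (by positivity) (by positivity)).1 h1
    have h1 := key _ hkR _ hkE
    have h2 := key _ hkR _ hkE'
    rw [quadForm_smul_of_norm_eq_one _ _ (hinv μ hμ),
      quadForm_smul_of_norm_eq_one _ _ (hinv ν hν)] at h1 h2
    exact eq_rankOneCov_of_certificate hu hP.le hlam hκ0 hκ1 hκw hZ hval hvec hQ hQP h1 h2

end Saddle

section NonpositiveRate

variable {n : ℕ} {W : MISOWiretap n}

/-- If `hR` is within `εR + εE` of a point `t hE` with `|t| ≤ 1`, then `ΩR` contains a convex
combination of points `± k` with `k` in `ΩE` up to a phase, so by convexity of `h ↦ h† Q h` no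
covariance matrix has a positive worst-case rate. -/
theorem worstCaseRate_nonpos (hεR : 0 ≤ W.εR) (hεE : 0 ≤ W.εE) {ω : ℂ} (hω : ‖ω‖ = 1) {t : ℝ}
    (ht0 : 0 ≤ t) (ht1 : t ≤ 1) (hdist : ‖W.hR - t • ω • W.hE‖ ≤ W.εR + W.εE)
    {Q : Matrix (Fin n) (Fin n) ℂ} (hQ : Q.PosSemidef) : W.worstCaseRate Q ≤ 0 := by
  have hω0 : ω ≠ 0 := by rintro rfl; simp at hω
  obtain ⟨e₁, e₂, he, he₁, he₂⟩ : ∃ e₁ e₂ : EuclideanSpace ℂ (Fin n),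
      W.hR - t • ω • W.hE = e₁ + e₂ ∧ ‖e₁‖ ≤ W.εR ∧ ‖e₂‖ ≤ W.εE := by
    rcases (add_nonneg hεR hεE).eq_or_lt with h0 | h0
    · rw [← h0] at hdist
      refine ⟨0, 0, ?_, by simpa using hεR, by simpa using hεE⟩
      simpa using hdist
    · have hb : ∀ ε : ℝ, 0 ≤ ε →
          ‖(ε / (W.εR + W.εE)) • (W.hR - t • ω • W.hE)‖ ≤ ε := fun ε hε => by
        rw [norm_smul, Real.norm_of_nonneg (by positivity), div_mul_eq_mul_div, div_le_iff₀ h0]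
        gcongr
      refine ⟨_, _, ?_, hb _ hεR, hb _ hεE⟩
      rw [← add_smul, ← add_div, div_self h0.ne', one_smul]
  have hkR : W.hR - e₁ ∈ W.ΩR := by simpa [ΩR] using he₁
  have hkE : ∀ σ : ℝ, |σ| = 1 → W.hE + ω⁻¹ • σ • e₂ ∈ W.ΩE := fun σ hσ => by
    simpa [ΩE, norm_smul, hω, hσ] using he₂
  have hconv : W.hR - e₁ =
      ((1 + t) / 2) • ω • (W.hE + ω⁻¹ • (1 : ℝ) • e₂) +
        ((1 - t) / 2) • (-ω) • (W.hE + ω⁻¹ • (-1 : ℝ) • e₂) := by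
    have h1 : W.hR - e₁ = t • ω • W.hE + e₂ := by
      rw [sub_eq_iff_eq_add] at he ⊢
      rw [he]
      abel
    rw [h1, neg_smul, smul_add ω, smul_add ω, smul_inv_smul₀ hω0, smul_inv_smul₀ hω0]
    module
  have hle : ∃ kE ∈ W.ΩE, quadForm Q (W.hR - e₁) ≤ quadForm Q kE := by
    by_contra! h
    have h1 := h _ (hkE 1 (by simp))
    have h2 := h _ (hkE (-1) (by simp))
    have h3 := quadForm_convexCombo_le hQ (ω • (W.hE + ω⁻¹ • (1 : ℝ) • e₂))
      ((-ω) • (W.hE + ω⁻¹ • (-1 : ℝ) • e₂)) (show 0 ≤ (1 + t) / 2 by linarith)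
      (show 0 ≤ (1 - t) / 2 by linarith) (by ring)
    rw [← hconv, quadForm_smul_of_norm_eq_one _ _ hω,
      quadForm_smul_of_norm_eq_one _ _ (by rwa [norm_neg])] at h3
    nlinarith
  obtain ⟨kE, hkE, hle⟩ := hle
  refine ((isLeast_rateSet hεR hεE hQ).2 ⟨_, hkR, kE, hkE, rfl⟩).trans ?_
  have h0 := quadForm_nonneg hQ (W.hR - e₁)
  rw [secrecyRate, sub_nonpos]
  gcongr

end NonpositiveRate

/-! ### The scalar parameters -/

section Parameters

variable {n : ℕ} {W : MISOWiretap n}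

theorem hR_ne_zero (hεR : 0 ≤ W.εR) (hR : W.εR < ‖W.hR‖) : W.hR ≠ 0 :=
  norm_pos_iff.1 (hεR.trans_lt hR)

theorem a_pos (hP : 0 < W.P) (hE : W.hE ≠ 0) : 0 < W.a := by
  have := norm_pos_iff.2 hE
  unfold a
  positivity

theorem b_pos (hP : 0 < W.P) (hR : W.hR ≠ 0) : 0 < W.b := by
  have := norm_pos_iff.2 hR
  unfold b
  positivity

theorem c_nonneg (hεR : 0 ≤ W.εR) : 0 ≤ W.c := div_nonneg hεR (norm_nonneg _)

theorem c_lt_one (hεR : 0 ≤ W.εR) (hR : W.εR < ‖W.hR‖) : W.c < 1 :=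
  (div_lt_one (hεR.trans_lt hR)).2 hR

theorem d_nonneg (hεE : 0 ≤ W.εE) : 0 ≤ W.d := div_nonneg hεE (norm_nonneg _)

theorem r_nonneg (W : MISOWiretap n) : 0 ≤ W.r := by unfold r; positivity

theorem r_le_one (W : MISOWiretap n) : W.r ≤ 1 :=
  div_le_one_of_le₀ ((norm_inner_le_norm _ _).trans_eq (mul_comm _ _)) (by positivity)

theorem sq_sqrt_one_sub_r_sq (W : MISOWiretap n) : √(1 - W.r ^ 2) ^ 2 = 1 - W.r ^ 2 :=
  Real.sq_sqrt (by nlinarith [W.r_nonneg, W.r_le_one])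

theorem sqrt_one_sub_sqrt_one_sub_r_sq_sq (W : MISOWiretap n) :
    √(1 - √(1 - W.r ^ 2) ^ 2) = W.r := by
  rw [W.sq_sqrt_one_sub_r_sq, sub_sub_cancel, Real.sqrt_sq W.r_nonneg]

theorem sqrt_one_sub_r_sq_le_one (W : MISOWiretap n) : √(1 - W.r ^ 2) ≤ 1 :=
  Real.sqrt_le_one.2 (by nlinarith [sq_nonneg W.r])

theorem z0_nonneg (W : MISOWiretap n) : 0 ≤ W.z0 := le_max_of_le_right (Real.sqrt_nonneg _)

theorem z0_le_one (hεR : 0 ≤ W.εR) (hR : W.εR < ‖W.hR‖) : W.z0 ≤ 1 :=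
  max_le (c_lt_one hεR hR).le W.sqrt_one_sub_r_sq_le_one

theorem z0_pos (hr1 : W.r < 1) : 0 < W.z0 :=
  lt_max_of_lt_right (Real.sqrt_pos.2 (by nlinarith [W.r_nonneg]))

theorem z0_lt_one (hεR : 0 ≤ W.εR) (hR : W.εR < ‖W.hR‖) (hr0 : 0 < W.r) : W.z0 < 1 := by
  refine max_lt (c_lt_one hεR hR) ?_
  rw [Real.sqrt_lt' one_pos]
  nlinarith

/-- The smallest eavesdropper correlation that is compatible with the receiver correlation `z` is
nonnegative. -/
theorem corrE_nonneg {z : ℝ} (hz : √(1 - W.r ^ 2) ≤ z) :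
    0 ≤ W.r * z - √(1 - W.r ^ 2) * √(1 - z ^ 2) := by
  have hs := Real.sqrt_nonneg (1 - W.r ^ 2)
  have h1 : √(1 - z ^ 2) ≤ W.r := by
    rw [Real.sqrt_le_left W.r_nonneg]
    nlinarith [W.sq_sqrt_one_sub_r_sq]
  nlinarith [mul_le_mul_of_nonneg_left h1 hs, mul_le_mul_of_nonneg_left hz W.r_nonneg]

theorem one_add_a_mul_sq_pos (hP : 0 < W.P) (hE : W.hE ≠ 0) (x : ℝ) :
    0 < 1 + W.a * x ^ 2 := by
  have := a_pos hP hE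
  positivity

theorem one_add_b_mul_sq_pos (hP : 0 < W.P) (hR : W.hR ≠ 0) (x : ℝ) :
    0 < 1 + W.b * x ^ 2 := by
  have := b_pos hP hR
  positivity

theorem one_lt_g_iff (hP : 0 < W.P) (hE : W.hE ≠ 0) (z : ℝ) :
    1 < W.g z ↔ W.a * (W.r * z - √(1 - W.r ^ 2) * √(1 - z ^ 2) + W.d) ^ 2 <
      W.b * (z - W.c) ^ 2 := by
  rw [g, one_lt_div (one_add_a_mul_sq_pos hP hE _), add_lt_add_iff_left]

theorem c_lt_of_one_lt_g (hP : 0 < W.P) (hE : W.hE ≠ 0) {z : ℝ} (hz : W.c ≤ z) (hg : 1 < W.g z) :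
    W.c < z := by
  refine lt_of_le_of_ne hz ?_
  rintro rfl
  have ha := a_pos hP hE
  rw [one_lt_g_iff hP hE, sub_self, zero_pow two_ne_zero, mul_zero] at hg
  exact absurd hg (not_lt.2 (by positivity))

theorem continuous_g (hP : 0 < W.P) (hE : W.hE ≠ 0) : Continuous W.g := by
  unfold g
  exact Continuous.div (by fun_prop) (by fun_prop) fun z => (one_add_a_mul_sq_pos hP hE _).ne'

theorem exists_isMaximizer (hεR : 0 ≤ W.εR) (hP : 0 < W.P) (hR : W.εR < ‖W.hR‖) (hE : W.hE ≠ 0) :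
    ∃ z, W.IsMaximizer z :=
  isCompact_Icc.exists_isMaxOn ⟨_, Set.right_mem_Icc.2 (z0_le_one hεR hR)⟩
    (continuous_g hP hE).continuousOn

theorem sqrt_b_div_a (hP : 0 < W.P) : √(W.b / W.a) = ‖W.hR‖ / ‖W.hE‖ := by
  rw [b, a, mul_div_mul_left _ _ hP.ne', ← div_pow, Real.sqrt_sq (by positivity)]

end Parameters

/-! ### The conditions for a positive rate -/

section Conditions

variable {n : ℕ} {W : MISOWiretap n}

/-- When `r ρ > 1` with `ρ = √(b / a)`, the function `z ↦ ρ z - (r z - s √(1 - z²))` is largest at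
`(ρ - r) / m`, with value `m = √(1 - r² + (ρ - r)²)`. -/
theorem exists_corrR_of_one_lt {ρ : ℝ} (hρ : 0 < ρ) (hεR : 0 ≤ W.εR) (hεE : 0 ≤ W.εE)
    (hrρ : 1 < W.r * ρ)
    (h : W.c * ρ + W.d < √(1 - W.r ^ 2 + (ρ - W.r) ^ 2)) :
    ∃ z, W.z0 < z ∧ z ≤ 1 ∧ √(1 - W.r ^ 2) * z + (W.r - ρ) * √(1 - z ^ 2) = 0 ∧
      W.r * z - √(1 - W.r ^ 2) * √(1 - z ^ 2) + W.d < ρ * (z - W.c) := by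
  have hc := c_nonneg hεR
  have hd := d_nonneg hεE
  have hr0 := W.r_nonneg
  have hr1 := W.r_le_one
  have hs := Real.sqrt_nonneg (1 - W.r ^ 2)
  have hs2 := W.sq_sqrt_one_sub_r_sq
  have hρr : 0 < ρ - W.r := by nlinarith
  rw [← hs2] at h
  unfold z0
  set s := √(1 - W.r ^ 2)
  set m := √(s ^ 2 + (ρ - W.r) ^ 2) with hm
  have hm0 : 0 < m := lt_of_le_of_lt (by positivity) h
  have hm2 : m ^ 2 = s ^ 2 + (ρ - W.r) ^ 2 := Real.sq_sqrt (by positivity)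
  have hy : √(1 - ((ρ - W.r) / m) ^ 2) = s / m := by
    rw [show 1 - ((ρ - W.r) / m) ^ 2 = (s / m) ^ 2 by field_simp; linarith,
      Real.sqrt_sq (by positivity)]
  have hφ : W.r * ((ρ - W.r) / m) - s * (s / m) + W.d < ρ * ((ρ - W.r) / m - W.c) := by
    have : ρ * ((ρ - W.r) / m) - (W.r * ((ρ - W.r) / m) - s * (s / m)) = m := by
      field_simp
      linarith
    linarith
  have hw : 0 < W.r * ((ρ - W.r) / m) - s * (s / m) := by
    have : W.r * ((ρ - W.r) / m) - s * (s / m) = (W.r * ρ - 1) / m := by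
      field_simp
      linarith
    rw [this]
    exact div_pos (by linarith) hm0
  refine ⟨(ρ - W.r) / m, max_lt ?_ ?_, ?_, ?_, ?_⟩
  · have : 0 < ρ * ((ρ - W.r) / m - W.c) := by linarith
    linarith [pos_of_mul_pos_right this hρ.le]
  · rw [lt_div_iff₀ hm0]
    refine lt_of_pow_lt_pow_left₀ 2 hρr.le ?_
    have h1 : s ^ 2 < W.r * (ρ - W.r) := by nlinarith
    have h2 : (s ^ 2) ^ 2 < (W.r * (ρ - W.r)) ^ 2 := pow_lt_pow_left₀ h1 (by positivity) two_ne_zero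
    rw [mul_pow, hm2]
    nlinarith
  · rw [div_le_one hm0]
    exact Real.le_sqrt_of_sq_le (by nlinarith [sq_nonneg s])
  · rw [hy]
    ring
  · rwa [hy]

/-- The two conditions in terms of the distance of `hR` to the points `t hE`, `|t| ≤ 1`, in units
of `‖hE‖`: it is `ρ s` if `r ρ ≤ 1`, and it is attained at `|t| = 1` otherwise. -/
theorem cond_iff (hεR : 0 ≤ W.εR) (hεE : 0 ≤ W.εE) {ρ : ℝ} (hρ : √(W.b / W.a) = ρ) (hρ0 : 0 < ρ) :
    W.cond1 ∨ W.cond2 ↔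
      (W.r * ρ ≤ 1 ∧ W.c * ρ + W.d < ρ * √(1 - W.r ^ 2)) ∨
      (1 < W.r * ρ ∧ W.c * ρ + W.d < √(1 - W.r ^ 2 + (ρ - W.r) ^ 2)) := by
  have hc := c_nonneg hεR
  have hd := d_nonneg hεE
  have hr0 := W.r_nonneg
  have hr1 := W.r_le_one
  have hs := Real.sqrt_nonneg (1 - W.r ^ 2)
  have hs2 := W.sq_sqrt_one_sub_r_sq
  have hsr := W.sqrt_one_sub_sqrt_one_sub_r_sq_sq
  have hz0s : √(1 - W.r ^ 2) ≤ W.z0 := le_max_right _ _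
  rw [cond1, cond2, hρ]
  constructor
  · rintro (⟨h1, h2⟩ | ⟨h1, h2⟩)
    · have hw := corrE_nonneg hz0s
      have hcz : W.c < W.z0 := by
        have : 0 < ρ * (W.z0 - W.c) := by linarith
        linarith [pos_of_mul_pos_right this hρ0.le]
      have hz0 : W.z0 = √(1 - W.r ^ 2) :=
        (max_choice _ _).resolve_left hcz.ne'
      rw [hz0, hsr] at h1 h2
      exact Or.inl ⟨by nlinarith, by nlinarith⟩
    · refine Or.inr ⟨?_, h2⟩
      have hy : √(1 - W.z0 ^ 2) ≤ W.r := by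
        rw [Real.sqrt_le_left W.r_nonneg]
        nlinarith
      have hy0 := Real.sqrt_nonneg (1 - W.z0 ^ 2)
      have h3 : W.r < ρ := by
        by_contra! h
        nlinarith [mul_nonneg (sub_nonneg.2 h) hy0, mul_nonneg hs W.z0_nonneg]
      nlinarith [mul_le_mul_of_nonneg_left hz0s hs,
        mul_le_mul_of_nonneg_left hy (sub_nonneg.2 h3.le)]
  · rintro (⟨h1, h2⟩ | ⟨h1, h2⟩)
    · have hz0 : W.z0 = √(1 - W.r ^ 2) := by
        refine max_eq_right (le_of_mul_le_mul_left ?_ hρ0)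
        linarith
      rw [hz0, hsr]
      exact Or.inl ⟨by nlinarith, by nlinarith⟩
    · obtain ⟨z, hz0, hz1, hz, -⟩ := exists_corrR_of_one_lt hρ0 hεR hεE h1 h2
      refine Or.inr ⟨?_, h2⟩
      have hy : √(1 - z ^ 2) < √(1 - W.z0 ^ 2) :=
        Real.sqrt_lt_sqrt (by nlinarith [W.z0_nonneg]) (by nlinarith [W.z0_nonneg])
      have hρr : 0 < ρ - W.r := by nlinarith
      nlinarith [mul_le_mul_of_nonneg_left hz0.le hs, mul_lt_mul_of_pos_left hy hρr]

/-- Under either condition `√(b / a) (z - c)` exceeds `r z - s √(1 - z²) + d` for some `z`: for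
`z = s = z0` or for the `z` of `exists_corrR_of_one_lt`. -/
theorem exists_one_lt_g (hεR : 0 ≤ W.εR) (hεE : 0 ≤ W.εE) (hP : 0 < W.P) (hR : W.εR < ‖W.hR‖)
    (hE : W.hE ≠ 0) (h : W.cond1 ∨ W.cond2) : ∃ z ∈ Set.Icc W.z0 1, 1 < W.g z := by
  have ha := a_pos hP hE
  have hb := b_pos hP (hR_ne_zero hεR hR)
  have hd := d_nonneg hεE
  have hρ0 : 0 < √(W.b / W.a) := Real.sqrt_pos.2 (by positivity)
  have hρ2 : W.a * √(W.b / W.a) ^ 2 = W.b := by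
    rw [Real.sq_sqrt (by positivity)]
    field_simp
  have key : ∀ z ∈ Set.Icc W.z0 1,
      W.r * z - √(1 - W.r ^ 2) * √(1 - z ^ 2) + W.d < √(W.b / W.a) * (z - W.c) →
      ∃ z ∈ Set.Icc W.z0 1, 1 < W.g z := by
    intro z hz hlt
    refine ⟨z, hz, (one_lt_g_iff hP hE z).2 ?_⟩
    have hw := corrE_nonneg ((le_max_right _ _).trans hz.1)
    rw [← hρ2, mul_assoc, ← mul_pow]
    exact mul_lt_mul_of_pos_left (pow_lt_pow_left₀ hlt (by positivity) two_ne_zero) ha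
  rcases (cond_iff hεR hεE rfl hρ0).1 h with ⟨h1, h2⟩ | ⟨h1, h2⟩
  · have hz0 : W.z0 = √(1 - W.r ^ 2) := by
      refine max_eq_right (le_of_mul_le_mul_left ?_ hρ0)
      linarith
    refine key W.z0 ⟨le_rfl, z0_le_one hεR hR⟩ ?_
    rw [hz0, W.sqrt_one_sub_sqrt_one_sub_r_sq_sq]
    nlinarith
  · obtain ⟨z, hz0, hz1, -, hz⟩ := exists_corrR_of_one_lt hρ0 hεR hεE h1 h2
    exact key z ⟨hz0.le, hz1⟩ hz

end Conditions

/-! ### Stationarity of the maximizers of `g` -/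

section Stationarity

theorem deriv_nonpos_of_eventually_le_right {f : ℝ → ℝ} {f' x : ℝ} (hf : HasDerivAt f f' x)
    (h : ∀ᶠ y in nhdsWithin x (Set.Ioi x), f y ≤ f x) : f' ≤ 0 := by
  have := (hasDerivWithinAt_iff_tendsto_slope' (Set.self_notMem_Ioi)).1
    (hf.hasDerivWithinAt (s := Set.Ioi x))
  refine le_of_tendsto this ?_
  filter_upwards [h, self_mem_nhdsWithin] with y hy hxy
  rw [slope_def_field]
  exact div_nonpos_of_nonpos_of_nonneg (by linarith) (sub_nonneg.2 (le_of_lt hxy))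

theorem deriv_nonneg_of_eventually_le_left {f : ℝ → ℝ} {f' x : ℝ} (hf : HasDerivAt f f' x)
    (h : ∀ᶠ y in nhdsWithin x (Set.Iio x), f y ≤ f x) : 0 ≤ f' := by
  have := (hasDerivWithinAt_iff_tendsto_slope' (Set.self_notMem_Iio)).1
    (hf.hasDerivWithinAt (s := Set.Iio x))
  refine ge_of_tendsto this ?_
  filter_upwards [h, self_mem_nhdsWithin] with y hy hxy
  rw [slope_def_field]
  exact div_nonneg_of_nonpos (by linarith) (sub_nonpos.2 (le_of_lt hxy))

variable {n : ℕ} {W : MISOWiretap n}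

/-- One half of the derivative, at `z = cos θ`, of
`θ ↦ (1 + b (cos θ - c)²) - lam (1 + a (r cos θ - s sin θ + d)²)`. For `lam = g z` it has the sign
of the derivative of `θ ↦ g (cos θ)`. The angle is a good coordinate because `√(1 - z²)` is not
differentiable at `z = 1`. -/
noncomputable def angularSlope (W : MISOWiretap n) (lam z : ℝ) : ℝ :=
  lam * (W.a * (W.r * z - √(1 - W.r ^ 2) * √(1 - z ^ 2) + W.d) *
    (√(1 - W.r ^ 2) * z + W.r * √(1 - z ^ 2))) - W.b * (z - W.c) * √(1 - z ^ 2)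

theorem IsMaximizer.angularSlope_sign (hP : 0 < W.P) (hE : W.hE ≠ 0) {z : ℝ}
    (hz : W.IsMaximizer z) :
    (z < 1 → 0 ≤ W.angularSlope (W.g z) z) ∧ (W.z0 < z → W.angularSlope (W.g z) z ≤ 0) := by
  obtain ⟨⟨hz0, hz1⟩, hmax⟩ := hz
  have hz0' : 0 ≤ z := W.z0_nonneg.trans hz0
  set lam := W.g z with hlam
  set s := √(1 - W.r ^ 2) with hs
  have hcos : Real.cos (Real.arccos z) = z := Real.cos_arccos (by linarith) hz1
  set H : ℝ → ℝ := fun θ => 1 + W.b * (Real.cos θ - W.c) ^ 2 -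
    lam * (1 + W.a * (W.r * Real.cos θ - s * Real.sin θ + W.d) ^ 2) with hH
  have hsin : Real.sin (Real.arccos z) = √(1 - z ^ 2) := Real.sin_arccos z
  have hderiv : HasDerivAt H (2 * W.angularSlope lam z) (Real.arccos z) := by
    have h1 := ((((Real.hasDerivAt_cos (Real.arccos z)).sub_const W.c).pow 2).const_mul
      W.b).const_add 1
    have h2 := (((((((Real.hasDerivAt_cos (Real.arccos z)).const_mul W.r).sub
      ((Real.hasDerivAt_sin (Real.arccos z)).const_mul s)).add_const W.d).pow 2).const_mul
      W.a).const_add 1).const_mul lam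
    refine (h1.sub h2).congr_deriv ?_
    simp only [hcos, hsin, angularSlope, ← hs, Pi.sub_apply]
    push_cast
    ring
  have hle : ∀ θ, 0 ≤ θ → θ ≤ Real.pi → W.z0 ≤ Real.cos θ → H θ ≤ 0 := by
    intro θ h0 hπ hzθ
    have h1 : W.g (Real.cos θ) ≤ lam := hmax ⟨hzθ, Real.cos_le_one θ⟩
    rw [g, div_le_iff₀ (one_add_a_mul_sq_pos hP hE _),
      ← Real.sin_eq_sqrt_one_sub_cos_sq h0 hπ] at h1
    exact sub_nonpos.2 h1
  have heq : H (Real.arccos z) = 0 := by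
    simp only [hH, hcos, hsin]
    rw [hlam, g, div_mul_cancel₀ _ (one_add_a_mul_sq_pos hP hE _).ne', sub_self]
  have harc0 := Real.arccos_nonneg z
  have harcπ : Real.arccos z < Real.pi :=
    lt_of_le_of_lt (Real.arccos_le_pi_div_two.2 hz0') (by linarith [Real.pi_pos])
  constructor
  · intro hz1
    have h0 : 0 < Real.arccos z := Real.arccos_pos.2 hz1
    have : 0 ≤ 2 * W.angularSlope lam z := by
      refine deriv_nonneg_of_eventually_le_left hderiv ?_
      filter_upwards [Ioo_mem_nhdsLT h0] with θ hθ
      rw [heq]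
      refine hle θ hθ.1.le (hθ.2.trans harcπ).le (hz0.trans ?_)
      rw [← hcos]
      exact Real.cos_le_cos_of_nonneg_of_le_pi hθ.1.le harcπ.le hθ.2.le
    linarith
  · intro hz0
    have : 2 * W.angularSlope lam z ≤ 0 := by
      refine deriv_nonpos_of_eventually_le_right hderiv ?_
      have hnear : ∀ᶠ θ in nhds (Real.arccos z), W.z0 < Real.cos θ :=
        Real.continuous_cos.continuousAt.eventually_const_lt (by rwa [hcos])
      filter_upwards [Ioo_mem_nhdsGT harcπ, nhdsWithin_le_nhds hnear] with θ hθ hzθ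
      rw [heq]
      exact hle θ (harc0.trans hθ.1.le) hθ.2.le hzθ.le
    linarith

/-- Near `z = 1` the term `√(1 - z²)` dominates, so the end point is not a maximizer: the angular
slope there is positive, while maximality on `[z0, 1]` would make it nonpositive. -/
theorem IsMaximizer.lt_one (hεR : 0 ≤ W.εR) (hεE : 0 ≤ W.εE) (hP : 0 < W.P)
    (hR : W.εR < ‖W.hR‖) (hE : W.hE ≠ 0) (hr0 : 0 < W.r) (hr1 : W.r < 1) {z : ℝ}
    (hz : W.IsMaximizer z) : z < 1 := by
  refine lt_of_le_of_ne hz.1.2 ?_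
  rintro rfl
  have h := (hz.angularSlope_sign hP hE).2 (z0_lt_one hεR hR hr0)
  have hs : 0 < √(1 - W.r ^ 2) := Real.sqrt_pos.2 (by nlinarith)
  have ha := a_pos hP hE
  have hd := d_nonneg hεE
  have hg : 0 < W.g 1 :=
    div_pos (one_add_b_mul_sq_pos hP (hR_ne_zero hεR hR) _) (one_add_a_mul_sq_pos hP hE _)
  simp only [angularSlope, one_pow, sub_self, Real.sqrt_zero, mul_zero, mul_one, sub_zero,
    add_zero] at h
  exact absurd h (not_le.2 (by positivity))

/-- First-order condition at a maximizer with a positive rate. At the boundary point `z = s`, where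
the eavesdropper correlation vanishes, only an inequality is available; the weight `κ` absorbs the
slack. -/
theorem IsMaximizer.exists_weight (hεR : 0 ≤ W.εR) (hεE : 0 ≤ W.εE) (hP : 0 < W.P)
    (hR : W.εR < ‖W.hR‖) (hE : W.hE ≠ 0) (hr0 : 0 < W.r) (hr1 : W.r < 1) {z : ℝ}
    (hz : W.IsMaximizer z) (hg : 1 < W.g z) :
    ∃ κ, 0 ≤ κ ∧ κ ≤ 1 ∧
      κ * (W.r * z - √(1 - W.r ^ 2) * √(1 - z ^ 2)) = W.r * z - √(1 - W.r ^ 2) * √(1 - z ^ 2) ∧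
      W.b * (z - W.c) * √(1 - z ^ 2) =
        W.g z * W.a * (W.r * z - √(1 - W.r ^ 2) * √(1 - z ^ 2) + κ * W.d) *
          (√(1 - W.r ^ 2) * z + W.r * √(1 - z ^ 2)) := by
  have hlt := hz.lt_one hεR hεE hP hR hE hr0 hr1
  have h1 := (hz.angularSlope_sign hP hE).1 hlt
  rcases hz.1.1.eq_or_lt with h0 | h0
  · have hb := b_pos hP (hR_ne_zero hεR hR)
    have ha := a_pos hP hE
    have hd := d_nonneg hεE
    have hcz := c_lt_of_one_lt_g hP hE ((le_max_left _ _).trans hz.1.1) hg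
    have hzs : z = √(1 - W.r ^ 2) :=
      h0.symm.trans ((max_choice _ _).resolve_left (h0.trans_ne hcz.ne'))
    have hy : √(1 - z ^ 2) = W.r := by rw [hzs, W.sqrt_one_sub_sqrt_one_sub_r_sq_sq]
    have hs2 := W.sq_sqrt_one_sub_r_sq
    have hw : W.r * z - z * W.r = 0 := by ring
    have hv : z * z + W.r * W.r = 1 := by rw [hzs]; linarith
    rw [angularSlope, ← hzs, hy, hw, hv] at h1
    rw [← hzs, hy, hw, hv]
    have hpos : 0 < W.b * (z - W.c) * W.r := by
      have : 0 < z - W.c := sub_pos.2 hcz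
      positivity
    -- the sign of the slope excludes `d = 0`
    have hD : 0 < W.g z * (W.a * W.d) := by linarith
    refine ⟨W.b * (z - W.c) * W.r / (W.g z * (W.a * W.d)), by positivity,
      (div_le_one hD).2 (by linarith), by simp, ?_⟩
    have : W.d ≠ 0 := by rintro h; simp [h] at hD
    have : W.g z ≠ 0 := by positivity
    field_simp
    ring
  · have h2 := (hz.angularSlope_sign hP hE).2 h0
    refine ⟨1, zero_le_one, le_rfl, one_mul _, ?_⟩
    have h3 := le_antisymm h2 h1
    rw [angularSlope] at h3
    linear_combination -h3

/-- For collinear estimates the maximizer is the end point `1`. -/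
theorem IsMaximizer.eq_one_of_r_eq_one (hεR : 0 ≤ W.εR) (hεE : 0 ≤ W.εE) (hP : 0 < W.P)
    (hR : W.εR < ‖W.hR‖) (hE : W.hE ≠ 0) (hr : W.r = 1) {z : ℝ}
    (hz : W.IsMaximizer z) (hg : 1 < W.g z) : z = 1 := by
  refine hz.1.2.eq_of_not_lt fun hlt => ?_
  have h1 : W.g 1 ≤ W.g z := hz.2 ⟨z0_le_one hεR hR, le_rfl⟩
  have ha := a_pos hP hE
  have hb := b_pos hP (hR_ne_zero hεR hR)
  have hc := c_nonneg hεR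
  have hd := d_nonneg hεE
  have hcz : W.c ≤ z := (le_max_left _ _).trans hz.1.1
  rw [one_lt_g_iff hP hE] at hg
  rw [g, g, div_le_div_iff₀ (one_add_a_mul_sq_pos hP hE _) (one_add_a_mul_sq_pos hP hE _)] at h1
  simp only [hr, one_pow, sub_self, Real.sqrt_zero, zero_mul, sub_zero, one_mul] at h1 hg
  have hX : 0 < z - W.c := (sub_nonneg.2 hcz).lt_of_ne fun h => by
    rw [← h] at hg
    nlinarith [mul_nonneg ha.le (sq_nonneg (z + W.d))]
  have hXY : z - W.c ≤ z + W.d := by linarith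
  have hab : W.a * (z + W.d) < W.b * (z - W.c) := by
    refine lt_of_mul_lt_mul_right ?_ hX.le
    nlinarith [mul_le_mul_of_nonneg_left hXY (mul_pos ha (hX.trans_le hXY)).le]
  have hab' : W.a ≤ W.b := by
    refine le_of_mul_le_mul_right ?_ hX
    nlinarith [mul_le_mul_of_nonneg_left hXY ha.le]
  have h2 : 0 ≤ W.a * W.b * ((W.c + W.d) * (2 * (z - W.c) * (z + W.d) +
      (1 - z) * (2 * z - W.c + W.d))) := by
    have : 0 ≤ 2 * z - W.c + W.d := by linarith
    have : 0 ≤ z + W.d := hX.le.trans hXY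
    have : 0 ≤ 1 - z := by linarith
    positivity
  -- the cross-multiplied difference of `g 1` and `g z`
  have h3 : 0 < (1 - z) * (2 * (W.b * (z - W.c) - W.a * (z + W.d)) + (1 - z) * (W.b - W.a) +
      W.a * W.b * ((W.c + W.d) * (2 * (z - W.c) * (z + W.d) +
      (1 - z) * (2 * z - W.c + W.d)))) := by
    have h4 : 0 ≤ (1 - z) * (W.b - W.a) := mul_nonneg (by linarith) (by linarith)
    exact mul_pos (by linarith) (by linarith)
  refine absurd h1 (not_le.2 (sub_pos.1 (h3.trans_eq ?_)))
  ring

theorem IsMaximizer.eq_one_of_r_eq_zero (hr : W.r = 0) {z : ℝ} (hz : W.IsMaximizer z) : z = 1 := by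
  refine le_antisymm hz.1.2 (le_trans ?_ hz.1.1)
  rw [z0, hr]
  simp

end Stationarity

/-! ### The geometry of the optimal direction -/

section Direction

/-- For unit vectors `x`, `y` with `|⟪x, y⟫| = r` and `s = √(1 - r²)`, the unit vector of their span
whose correlation with `x` is `z = √(1 - t²)` and whose correlation with `y` is as small as
possible, namely `r z - s t`. The last identity says that the components of `x` and `y` orthogonal
to it are parallel. -/
theorem correlations_of_combination {E : Type*} [NormedAddCommGroup E] [InnerProductSpace ℂ E]
    {x y : E} {r s z t : ℝ} (hx : ‖x‖ = 1) (hy : ‖y‖ = 1) (hr : ‖inner ℂ x y‖ = r)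
    (hr0 : r ≠ 0) (hs0 : s ≠ 0) (hs : s ^ 2 = 1 - r ^ 2) (ht : t ^ 2 = 1 - z ^ 2) {u : E}
    (hu : u = ((t / s : ℝ) : ℂ) • y - (((t / s + z / r : ℝ) : ℂ) * inner ℂ x y) • x) :
    ‖u‖ = 1 ∧ inner ℂ u ((-(inner ℂ x y / r)) • x) = (z : ℂ) ∧
      inner ℂ u ((-1 : ℂ) • y) = ((r * z - s * t : ℝ) : ℂ) ∧
      (s * z + r * t) • ((-(inner ℂ x y / r)) • x - z • u) =
        t • ((-1 : ℂ) • y - (r * z - s * t) • u) := by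
  have hxx : inner ℂ x x = (1 : ℂ) := by rw [inner_self_eq_norm_sq_to_K, hx]; simp
  have hyy : inner ℂ y y = (1 : ℂ) := by rw [inner_self_eq_norm_sq_to_K, hy]; simp
  have hγ : inner ℂ x y * inner ℂ y x = ((r : ℂ)) ^ 2 := by
    rw [← inner_conj_symm y x, Complex.mul_conj', hr]
  have hr0' : (r : ℂ) ≠ 0 := by exact_mod_cast hr0
  have hs0' : (s : ℂ) ≠ 0 := by exact_mod_cast hs0
  have hs' : (s : ℂ) ^ 2 = 1 - (r : ℂ) ^ 2 := by exact_mod_cast hs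
  have ht' : (t : ℂ) ^ 2 = 1 - (z : ℂ) ^ 2 := by exact_mod_cast ht
  have hux : inner ℂ u x = -(z / r * inner ℂ y x) := by
    rw [hu, inner_sub_left, inner_smul_left, inner_smul_left, hxx, map_mul, inner_conj_symm,
      Complex.conj_ofReal, Complex.conj_ofReal]
    push_cast
    ring
  have huy : inner ℂ u y = -((r * z - s * t : ℝ) : ℂ) := by
    rw [hu, inner_sub_left, inner_smul_left, inner_smul_left, hyy, map_mul, inner_conj_symm,
      Complex.conj_ofReal, Complex.conj_ofReal, mul_assoc, mul_comm (inner ℂ y x), hγ]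
    push_cast
    field_simp
    linear_combination (-t : ℂ) * hs'
  refine ⟨?_, ?_, ?_, ?_⟩
  · have huu : inner ℂ u u = (1 : ℂ) := by
      nth_rewrite 2 [hu]
      rw [inner_sub_right, inner_smul_right, inner_smul_right, hux, huy]
      have h1 : ((t / s + z / r : ℝ) : ℂ) * inner ℂ x y * -(z / r * inner ℂ y x) =
          -(((t / s + z / r : ℝ) : ℂ) * (z / r)) * (inner ℂ x y * inner ℂ y x) := by ring
      rw [h1, hγ]
      push_cast
      field_simp
      linear_combination (s : ℂ) * ht'
    have h2 : ‖u‖ ^ 2 = 1 := by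
      rw [← inner_self_eq_norm_sq (𝕜 := ℂ), huu]
      simp
    exact (pow_eq_one_iff_of_nonneg (norm_nonneg _) two_ne_zero).1 h2
  · rw [inner_smul_right, hux]
    have h1 : -(inner ℂ x y / (r : ℂ)) * -(z / r * inner ℂ y x) =
        z / r / r * (inner ℂ x y * inner ℂ y x) := by ring
    rw [h1, hγ]
    field_simp
  · rw [inner_smul_right, huy]
    ring
  · have h1 : ((s * z + r * t) * z - t * (r * z - s * t)) • u = s • u := by
      congr 1
      linear_combination s * ht
    have h2 : s • u = (t : ℝ) • y - (((s * z + r * t) / r : ℝ) : ℂ) • inner ℂ x y • x := by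
      rw [hu, smul_sub, ← Complex.coe_smul, ← Complex.coe_smul, smul_smul, smul_smul, smul_smul]
      congr 2
      · push_cast; field_simp; rfl
      · push_cast; field_simp; ring
    have h3 : (s * z + r * t) • (-(inner ℂ x y / (r : ℂ))) • x =
        -((((s * z + r * t) / r : ℝ) : ℂ) • inner ℂ x y • x) := by
      rw [← Complex.coe_smul, smul_smul, smul_smul, ← neg_smul]
      congr 1
      push_cast
      ring
    rw [← sub_eq_zero]
    have h4 : (s * z + r * t) • ((-(inner ℂ x y / (r : ℂ))) • x - z • u) -
        t • ((-1 : ℂ) • y - (r * z - s * t) • u) =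
        (s * z + r * t) • (-(inner ℂ x y / (r : ℂ))) • x + t • y -
          ((s * z + r * t) * z - t * (r * z - s * t)) • u := by
      rw [neg_one_smul]
      module
    rw [h4, h1, h2, h3]
    abel

variable {n : ℕ} {W : MISOWiretap n}

theorem P_mul_sq_sub (hR : W.hR ≠ 0) (z : ℝ) :
    W.P * (z * ‖W.hR‖ - W.εR) ^ 2 = W.b * (z - W.c) ^ 2 := by
  have := norm_ne_zero_iff.2 hR
  rw [b, c]
  field_simp

theorem P_mul_sq_add (hE : W.hE ≠ 0) (w : ℝ) :
    W.P * (w * ‖W.hE‖ + W.εE) ^ 2 = W.a * (w + W.d) ^ 2 := by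
  have := norm_ne_zero_iff.2 hE
  rw [a, d]
  field_simp

theorem εR_lt_mul_norm (hR : W.hR ≠ 0) {z : ℝ} (hz : W.c < z) : W.εR < z * ‖W.hR‖ :=
  (div_lt_iff₀ (norm_pos_iff.2 hR)).1 hz

theorem value_eq (hP : 0 < W.P) (hR : W.hR ≠ 0) (hE : W.hE ≠ 0) (z : ℝ) :
    1 + W.P * (z * ‖W.hR‖ - W.εR) ^ 2 =
      W.g z * (1 + W.P * ((W.r * z - √(1 - W.r ^ 2) * √(1 - z ^ 2)) * ‖W.hE‖ + W.εE) ^ 2) := by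
  rw [P_mul_sq_sub hR, P_mul_sq_add hE, g, div_mul_cancel₀ _ (one_add_a_mul_sq_pos hP hE _).ne']

/-- A maximizer `z` of `g` with `g z > 1` yields a direction that satisfies the hypotheses of the
certificate. -/
theorem IsMaximizer.certificate (hεR : 0 ≤ W.εR) (hεE : 0 ≤ W.εE) (hP : 0 < W.P)
    (hR : W.εR < ‖W.hR‖) (hE : W.hE ≠ 0) {z : ℝ} (hz : W.IsMaximizer z) (hg : 1 < W.g z) :
    ‖W.uStar z‖ = 1 ∧ ‖inner ℂ (W.uStar z) W.hR‖ = z * ‖W.hR‖ ∧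
      W.worstCaseRate (rankOneCov W.P (W.uStar z)) = Real.log (W.g z) ∧
      ∀ Q ∈ W.feasible, Real.log (W.g z) ≤ W.worstCaseRate Q →
        Q = rankOneCov W.P (W.uStar z) := by
  have hR0 := hR_ne_zero hεR hR
  have hRn := norm_pos_iff.2 hR0
  have hEn := norm_pos_iff.2 hE
  have hRn' : (‖W.hR‖ : ℂ) ≠ 0 := by exact_mod_cast hRn.ne'
  have hEn' : (‖W.hE‖ : ℂ) ≠ 0 := by exact_mod_cast hEn.ne'
  have hz0 : 0 ≤ z := W.z0_nonneg.trans hz.1.1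
  have hcz : W.c < z := c_lt_of_one_lt_g hP hE ((le_max_left _ _).trans hz.1.1) hg
  have hw : 0 ≤ W.r * z - √(1 - W.r ^ 2) * √(1 - z ^ 2) :=
    corrE_nonneg ((le_max_right _ _).trans hz.1.1)
  have hZ := εR_lt_mul_norm hR0 hcz
  have hval := value_eq hP hR0 hE z
  -- all cases reduce to the data of the certificate
  suffices h : ∃ (μ ν : ℂ) (κ : ℝ), ‖W.uStar z‖ = 1 ∧ ‖μ‖ = 1 ∧ ‖ν‖ = 1 ∧ 0 ≤ κ ∧ κ ≤ 1 ∧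
      κ * (W.r * z - √(1 - W.r ^ 2) * √(1 - z ^ 2)) =
        W.r * z - √(1 - W.r ^ 2) * √(1 - z ^ 2) ∧
      inner ℂ (W.uStar z) (μ • W.hR) = ((z * ‖W.hR‖ : ℝ) : ℂ) ∧
      inner ℂ (W.uStar z) (ν • W.hE) =
        (((W.r * z - √(1 - W.r ^ 2) * √(1 - z ^ 2)) * ‖W.hE‖ : ℝ) : ℂ) ∧
      (z * ‖W.hR‖ - W.εR) • (μ • W.hR - (z * ‖W.hR‖) • W.uStar z) =
        (W.g z * ((W.r * z - √(1 - W.r ^ 2) * √(1 - z ^ 2)) * ‖W.hE‖ + κ * W.εE)) •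
          (ν • W.hE - ((W.r * z - √(1 - W.r ^ 2) * √(1 - z ^ 2)) * ‖W.hE‖) • W.uStar z) by
    obtain ⟨μ, ν, κ, hu, hμ, hν, hκ0, hκ1, hκ, h1, h2, h3⟩ := h
    refine ⟨hu, ?_, worstCaseRate_of_certificate hεR hεE hP hu hμ hν hg hκ0 hκ1
      (by rw [← mul_assoc, hκ]) (by positivity) hZ h1 h2 hval h3⟩
    have := congrArg norm h1
    rwa [inner_smul_right, norm_mul, hμ, one_mul, Complex.norm_real,
      Real.norm_of_nonneg (by positivity)] at this
  by_cases hr : 0 < W.r ∧ W.r < 1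
  · obtain ⟨hr0, hr1⟩ := hr
    obtain ⟨κ, hκ0, hκ1, hκ, hstat⟩ := hz.exists_weight hεR hεE hP hR hE hr0 hr1 hg
    have hs : 0 < √(1 - W.r ^ 2) := Real.sqrt_pos.2 (by nlinarith)
    have hu : W.uStar z = ((√(1 - z ^ 2) / √(1 - W.r ^ 2) : ℝ) : ℂ) • ((‖W.hE‖ : ℂ)⁻¹ • W.hE) -
        (((√(1 - z ^ 2) / √(1 - W.r ^ 2) + z / W.r : ℝ) : ℂ) *
          inner ℂ ((‖W.hR‖ : ℂ)⁻¹ • W.hR) ((‖W.hE‖ : ℂ)⁻¹ • W.hE)) • ((‖W.hR‖ : ℂ)⁻¹ • W.hR) := by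
      rw [uStar, if_pos ⟨hr0, hr1⟩, Real.sqrt_div' _ (by nlinarith), inner_smul_left,
        inner_smul_right, smul_smul, smul_smul]
      congr 2
      · push_cast
        rw [div_eq_mul_inv]
      · rw [map_inv₀, Complex.conj_ofReal]
        push_cast
        field_simp
    have hRu : ‖(‖W.hR‖ : ℂ)⁻¹ • W.hR‖ = 1 := norm_smul_inv_norm hR0
    have hEu : ‖(‖W.hE‖ : ℂ)⁻¹ • W.hE‖ = 1 := norm_smul_inv_norm hE
    have hRs : W.hR = (‖W.hR‖ : ℂ) • ((‖W.hR‖ : ℂ)⁻¹ • W.hR) := (smul_inv_smul₀ hRn' _).symm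
    have hEs : W.hE = (‖W.hE‖ : ℂ) • ((‖W.hE‖ : ℂ)⁻¹ • W.hE) := (smul_inv_smul₀ hEn' _).symm
    have hγ : ‖inner ℂ ((‖W.hR‖ : ℂ)⁻¹ • W.hR) ((‖W.hE‖ : ℂ)⁻¹ • W.hE)‖ = W.r := by
      rw [inner_smul_left, inner_smul_right, norm_mul, norm_mul, r, norm_inner_symm W.hE]
      simp
      field_simp
    generalize (‖W.hR‖ : ℂ)⁻¹ • W.hR = x at *
    generalize (‖W.hE‖ : ℂ)⁻¹ • W.hE = y at *
    obtain ⟨h1, h2, h3, h4⟩ := correlations_of_combination hRu hEu hγ hr0.ne' hs.ne'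
      W.sq_sqrt_one_sub_r_sq (Real.sq_sqrt (show 0 ≤ 1 - z ^ 2 by nlinarith [hz.1.2])) hu
    have hv : 0 < √(1 - W.r ^ 2) * z + W.r * √(1 - z ^ 2) := by
      have := (z0_pos hr1).trans_le hz.1.1
      positivity
    have hμR : -(inner ℂ x y / (W.r : ℂ)) • W.hR = ‖W.hR‖ • (-(inner ℂ x y / (W.r : ℂ))) • x := by
      nth_rewrite 1 [hRs]
      rw [smul_comm, Complex.coe_smul]
    have hνE : (-1 : ℂ) • W.hE = ‖W.hE‖ • (-1 : ℂ) • y := by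
      nth_rewrite 1 [hEs]
      rw [smul_comm, Complex.coe_smul]
    refine ⟨-(inner ℂ x y / W.r), -1, κ, h1, ?_, by simp, hκ0, hκ1, hκ, ?_, ?_, ?_⟩
    · rw [norm_neg, norm_div, hγ, Complex.norm_real, Real.norm_of_nonneg hr0.le, div_self hr0.ne']
    · rw [hμR, inner_smul_right_eq_smul, h2, Complex.real_smul]
      push_cast
      ring
    · rw [hνE, inner_smul_right_eq_smul, h3, Complex.real_smul]
      push_cast
      ring
    · rw [hμR, hνE]
      generalize (-(inner ℂ x y / (W.r : ℂ))) • x = X at *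
      generalize (-1 : ℂ) • y = Y at *
      generalize W.uStar z = u at *
      generalize √(1 - z ^ 2) = t at *
      generalize √(1 - W.r ^ 2) = s at *
      have hscal : (z * ‖W.hR‖ - W.εR) * ‖W.hR‖ * t =
          W.g z * ((W.r * z - s * t) * ‖W.hE‖ + κ * W.εE) * ‖W.hE‖ * (s * z + W.r * t) := by
        rw [b, a, c, d] at hstat
        field_simp at hstat
        linear_combination hstat
      refine smul_right_injective _ hv.ne' ?_
      calc (s * z + W.r * t) • ((z * ‖W.hR‖ - W.εR) • (‖W.hR‖ • X - (z * ‖W.hR‖) • u))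
          = ((z * ‖W.hR‖ - W.εR) * ‖W.hR‖) • ((s * z + W.r * t) • (X - z • u)) := by module
        _ = ((z * ‖W.hR‖ - W.εR) * ‖W.hR‖ * t) • (Y - (W.r * z - s * t) • u) := by
          rw [h4, smul_smul]
        _ = _ := by
          rw [hscal]
          module
  · have hu : W.uStar z = ((1 / ‖W.hR‖ : ℝ) : ℂ) • W.hR := by rw [uStar, if_neg hr]
    have hu1 : ‖W.uStar z‖ = 1 := by
      rw [hu, norm_smul]
      simp
      field_simp
    have hur : ‖W.hR‖ • W.uStar z = W.hR := by
      rw [hu, ← Complex.coe_smul, smul_smul]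
      push_cast
      rw [mul_one_div_cancel hRn', one_smul]
    have huR : inner ℂ (W.uStar z) W.hR = (‖W.hR‖ : ℂ) := by
      rw [← congrArg (inner ℂ (W.uStar z)) hur, inner_smul_right_eq_smul,
        inner_self_eq_norm_sq_to_K, hu1]
      simp
    have huE : ‖inner ℂ (W.uStar z) W.hE‖ = W.r * ‖W.hE‖ := by
      rw [hu, inner_smul_left, norm_mul, r, norm_inner_symm W.hR]
      simp
      field_simp
    rcases W.r_nonneg.eq_or_lt with hr0 | hr0
    · -- `hE` is orthogonal to the direction, which is stationary with the symmetric mixture `κ = 0`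
      obtain rfl := hz.eq_one_of_r_eq_zero hr0.symm
      have huE' : inner ℂ (W.uStar 1) W.hE = (0 : ℂ) := by
        rw [← norm_eq_zero, huE, ← hr0, zero_mul]
      refine ⟨1, 1, 0, hu1, norm_one, norm_one, le_rfl, zero_le_one, ?_, ?_, ?_, ?_⟩
      · simp [← hr0]
      · rw [one_smul, huR, one_mul]
      · rw [one_smul, huE']
        simp [← hr0]
      · rw [one_smul, one_mul, hur]
        simp [← hr0]
    · have hr1 : W.r = 1 := le_antisymm W.r_le_one (not_lt.1 fun h => hr ⟨hr0, h⟩)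
      obtain rfl := hz.eq_one_of_r_eq_one hεR hεE hP hR hE hr1 hg
      rw [hr1, one_mul] at huE
      have hν : ‖(inner ℂ W.hE (W.uStar 1) : ℂ) / ‖W.hE‖‖ = 1 := by
        rw [norm_div, norm_inner_symm, huE]
        simp [hE]
      have huνE : inner ℂ (W.uStar 1) (((inner ℂ W.hE (W.uStar 1) : ℂ) / ‖W.hE‖) • W.hE) =
          (‖W.hE‖ : ℂ) := by
        rw [inner_smul_right, div_mul_eq_mul_div, ← inner_conj_symm W.hE, Complex.conj_mul', huE]
        field_simp
      have hνE : ((inner ℂ W.hE (W.uStar 1) : ℂ) / ‖W.hE‖) • W.hE = ‖W.hE‖ • W.uStar 1 := by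
        have h1 := (inner_eq_norm_mul_iff (𝕜 := ℂ) (x := W.uStar 1)
          (y := ((inner ℂ W.hE (W.uStar 1) : ℂ) / ‖W.hE‖) • W.hE)).1 (by
            rw [huνE, norm_smul, hν, hu1]
            simp)
        rw [norm_smul, hν, hu1, one_mul] at h1
        simpa using h1.symm
      refine ⟨1, _, 1, hu1, norm_one, hν, zero_le_one, le_rfl, one_mul _, ?_, ?_, ?_⟩
      · rw [one_smul, huR, one_mul]
      · rw [huνE, hr1]
        simp
      · rw [one_smul, hνE, hr1]
        simp [hur]

end Direction

/-! ### The polynomial of degree six -/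

section Sextic

open Polynomial

theorem charpoly_companion_six {R : Type*} [CommRing R] (m : Fin 6 → R) :
    (!![-(m 0), -(m 1), -(m 2), -(m 3), -(m 4), -(m 5);
        1, 0, 0, 0, 0, 0;
        0, 1, 0, 0, 0, 0;
        0, 0, 1, 0, 0, 0;
        0, 0, 0, 1, 0, 0;
        0, 0, 0, 0, 1, 0] : Matrix (Fin 6) (Fin 6) R).charpoly =
      X ^ 6 + C (m 0) * X ^ 5 + C (m 1) * X ^ 4 + C (m 2) * X ^ 3 + C (m 3) * X ^ 2 +
        C (m 4) * X + C (m 5) := by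
  have hmat : Matrix.charmatrix (!![-(m 0), -(m 1), -(m 2), -(m 3), -(m 4), -(m 5);
        1, 0, 0, 0, 0, 0;
        0, 1, 0, 0, 0, 0;
        0, 0, 1, 0, 0, 0;
        0, 0, 0, 1, 0, 0;
        0, 0, 0, 0, 1, 0] : Matrix (Fin 6) (Fin 6) R) =
      !![X + C (m 0), C (m 1), C (m 2), C (m 3), C (m 4), C (m 5);
        -1, X, 0, 0, 0, 0;
        0, -1, X, 0, 0, 0;
        0, 0, -1, X, 0, 0;
        0, 0, 0, -1, X, 0;
        0, 0, 0, 0, -1, X] := by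
    ext i j : 2
    fin_cases i <;> fin_cases j <;> simp
  rw [Matrix.charpoly, hmat]
  simp [Matrix.det_succ_row_zero, Fin.sum_univ_succ, Fin.succAbove, Matrix.submatrix]
  ring

variable {n : ℕ} {W : MISOWiretap n}

theorem a0_ne_zero (hεR : 0 ≤ W.εR) (hεE : 0 ≤ W.εE) (hP : 0 < W.P) (hR : W.εR < ‖W.hR‖)
    (hE : W.hE ≠ 0) (hr0 : 0 < W.r) (hr1 : W.r < 1) : W.a0 ≠ 0 := by
  have ha := a_pos hP hE
  have hb := b_pos hP (hR_ne_zero hεR hR)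
  have hc := c_nonneg hεR
  have hd := d_nonneg hεE
  have hs : 0 < √(1 - W.r ^ 2) := Real.sqrt_pos.2 (by nlinarith)
  have h1 : W.p1 * W.q0 ≤ 0 := by
    rw [p1, q0, neg_mul, neg_mul, neg_mul, neg_nonpos]
    positivity
  have h2 : 0 < W.p0 * W.q1 := by
    rw [p0, q1]
    positivity
  rw [a0]
  linarith

theorem natDegree_sextic (h : W.a0 ≠ 0) : W.sextic.natDegree = 6 := by
  unfold sextic
  compute_degree!

theorem sextic_eq (h : W.a0 ≠ 0) : W.sextic = C W.a0 * W.G.charpoly := by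
  have := charpoly_companion_six
    ![W.a1 / W.a0, W.a2 / W.a0, W.a3 / W.a0, W.a4 / W.a0, W.a5 / W.a0, W.a6 / W.a0]
  change W.G.charpoly = _ at this
  have hC : ∀ x : ℝ, C W.a0 * C (x / W.a0) = C x := fun x => by
    rw [← C_mul, mul_div_cancel₀ _ h]
  rw [this, sextic, ← hC W.a1, ← hC W.a2, ← hC W.a3, ← hC W.a4, ← hC W.a5, ← hC W.a6]
  simp only [Matrix.cons_val]
  ring

theorem map_sextic_eq (h : W.a0 ≠ 0) :
    W.sextic.map (algebraMap ℝ ℂ) = C (W.a0 : ℂ) * W.GC.charpoly := by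
  have : W.GC.charpoly = W.G.charpoly.map (algebraMap ℝ ℂ) :=
    Matrix.charpoly_map W.G (algebraMap ℝ ℂ)
  rw [this, sextic_eq h, Polynomial.map_mul, map_C]
  rfl

theorem hasEigenvalue_GC_iff (h : W.a0 ≠ 0) (l : ℂ) :
    Module.End.HasEigenvalue (Matrix.toLin' W.GC) l ↔ aeval l W.sextic = 0 := by
  rw [Module.End.hasEigenvalue_iff_isRoot_charpoly, Matrix.charpoly_toLin',
    ← eval_map_algebraMap, map_sextic_eq h, eval_mul, eval_C, mul_eq_zero, IsRoot]
  simp [h]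

theorem hasEigenvalue_GC_ofReal_iff (h : W.a0 ≠ 0) (x : ℝ) :
    Module.End.HasEigenvalue (Matrix.toLin' W.GC) (x : ℂ) ↔ W.sextic.eval x = 0 := by
  have : aeval (x : ℂ) W.sextic = ((W.sextic.eval x : ℝ) : ℂ) :=
    aeval_algebraMap_apply_eq_algebraMap_eval x W.sextic
  rw [hasEigenvalue_GC_iff h, this, Complex.ofReal_eq_zero]

theorem sqrt_one_sub_zOf_sq {x : ℝ} (h0 : 0 ≤ x) (h1 : x ≤ 1) :
    √(1 - zOf x ^ 2) = (1 - x ^ 2) / (1 + x ^ 2) := by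
  have h2 : 0 ≤ 1 - x ^ 2 := by nlinarith
  rw [zOf, show 1 - (2 * x / (1 + x ^ 2)) ^ 2 = ((1 - x ^ 2) / (1 + x ^ 2)) ^ 2 by
    field_simp; ring, Real.sqrt_sq (by positivity)]

/-- In the rational coordinate `z = 2x / (1 + x²)`, `√(1 - z²) = (1 - x²) / (1 + x²)` the sextic is
the numerator of the derivative of `g`, up to sign. -/
theorem eval_sextic_eq (hP : 0 < W.P) (hE : W.hE ≠ 0) {x : ℝ} (h0 : 0 ≤ x) (h1 : x ≤ 1) :
    W.sextic.eval x = 4 * (1 + x ^ 2) ^ 3 *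
      (1 + W.a * (W.r * zOf x - √(1 - W.r ^ 2) * √(1 - zOf x ^ 2) + W.d) ^ 2) *
      W.angularSlope (W.g (zOf x)) (zOf x) := by
  have hδ := (one_add_a_mul_sq_pos hP hE
    (W.r * zOf x - √(1 - W.r ^ 2) * √(1 - zOf x ^ 2) + W.d)).ne'
  have hs2 := W.sq_sqrt_one_sub_r_sq
  have hN : (1 + W.a * (W.r * zOf x - √(1 - W.r ^ 2) * √(1 - zOf x ^ 2) + W.d) ^ 2) *
      W.angularSlope (W.g (zOf x)) (zOf x) =
      (1 + W.b * (zOf x - W.c) ^ 2) *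
        (W.a * (W.r * zOf x - √(1 - W.r ^ 2) * √(1 - zOf x ^ 2) + W.d) *
          (√(1 - W.r ^ 2) * zOf x + W.r * √(1 - zOf x ^ 2))) -
      (1 + W.a * (W.r * zOf x - √(1 - W.r ^ 2) * √(1 - zOf x ^ 2) + W.d) ^ 2) *
        (W.b * (zOf x - W.c) * √(1 - zOf x ^ 2)) := by
    rw [angularSlope, g]
    field_simp
  rw [mul_assoc, hN, sqrt_one_sub_zOf_sq h0 h1]
  simp only [sextic, eval_add, eval_mul, eval_C, eval_pow, eval_X, a0, a1, a2, a3, a4, a5, a6,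
    p0, p1, p2, q0, q1, q2, q3, q4, zOf]
  generalize √(1 - W.r ^ 2) = s at *
  generalize W.r = r at *
  generalize W.a = a at *
  generalize W.b = b at *
  generalize W.c = c at *
  generalize W.d = d at *
  have hx : 1 + x ^ 2 ≠ 0 := by positivity
  field_simp
  -- `q2` is the middle coefficient of the expanded denominator plus `2 a (s² + r² - 1)`
  linear_combination 2 * a * (1 + x ^ 2) * (-2 * (1 + b * c ^ 2) * x ^ 5 + 4 * b * c * x ^ 4 -
    4 * b * c * x ^ 2 + 2 * (1 + b * c ^ 2) * x) * hs2

theorem strictMonoOn_zOf : StrictMonoOn zOf (Set.Icc 0 1) := by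
  intro x hx y hy hxy
  rw [zOf, zOf, div_lt_div_iff₀ (by positivity) (by positivity)]
  have : 0 < 1 - x * y := by nlinarith [hx.1, hx.2, hy.1, hy.2]
  nlinarith [mul_pos (sub_pos.2 hxy) this]

theorem zOf_one : zOf 1 = 1 := by norm_num [zOf]

theorem zOf_inv {z : ℝ} (h0 : 0 < z) (h1 : z ≤ 1) :
    (1 - √(1 - z ^ 2)) / z ∈ Set.Icc (0 : ℝ) 1 ∧ zOf ((1 - √(1 - z ^ 2)) / z) = z := by
  have hy0 := Real.sqrt_nonneg (1 - z ^ 2)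
  have hy2 : √(1 - z ^ 2) ^ 2 = 1 - z ^ 2 := Real.sq_sqrt (by nlinarith)
  set y := √(1 - z ^ 2)
  have hy1 : y < 1 := by nlinarith
  refine ⟨⟨div_nonneg (by linarith) h0.le, ?_⟩, ?_⟩
  · rw [div_le_one h0]
    nlinarith
  · have h2 : 0 < z ^ 2 + (1 - y) ^ 2 := by positivity
    rw [zOf, div_eq_iff (by positivity)]
    field_simp
    nlinarith

theorem zOf_mem_Icc (hr1 : W.r < 1) (hz0 : W.z0 ≤ 1) {x : ℝ} (hx : x ∈ Set.Icc W.x0 1) :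
    zOf x ∈ Set.Icc W.z0 1 := by
  obtain ⟨h1, h2⟩ := zOf_inv (z0_pos hr1) hz0
  have hx' : x ∈ Set.Icc (0 : ℝ) 1 := ⟨h1.1.trans hx.1, hx.2⟩
  refine ⟨h2.symm.trans_le (strictMonoOn_zOf.monotoneOn h1 hx' hx.1), ?_⟩
  exact (strictMonoOn_zOf.monotoneOn hx' ⟨zero_le_one, le_rfl⟩ hx.2).trans_eq zOf_one

/-- Interior maximizers are zeros of the slope, hence of the sextic; the end point `1` is excluded. -/
theorem IsMaximizer.exists_candidate (hεR : 0 ≤ W.εR) (hεE : 0 ≤ W.εE) (hP : 0 < W.P)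
    (hR : W.εR < ‖W.hR‖) (hE : W.hE ≠ 0) (hr0 : 0 < W.r) (hr1 : W.r < 1) {z : ℝ}
    (hz : W.IsMaximizer z) : ∃ x ∈ W.candidates, z = zOf x := by
  have hz0 := z0_le_one hεR hR
  obtain ⟨h1, h2⟩ := zOf_inv ((z0_pos hr1).trans_le hz.1.1) hz.1.2
  obtain ⟨h3, h4⟩ := zOf_inv (z0_pos hr1) hz0
  refine ⟨_, ⟨⟨?_, h1.2⟩, ?_⟩, h2.symm⟩
  · refine (strictMonoOn_zOf.le_iff_le h3 h1).1 ?_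
    rw [h4, h2]
    exact hz.1.1
  · rcases hz.1.1.eq_or_lt with h | h
    · left
      rw [← h]
      rfl
    · right
      have hsign := hz.angularSlope_sign hP hE
      rw [hasEigenvalue_GC_ofReal_iff (a0_ne_zero hεR hεE hP hR hE hr0 hr1),
        eval_sextic_eq hP hE h1.1 h1.2, h2,
        le_antisymm (hsign.2 h) (hsign.1 (hz.lt_one hεR hεE hP hR hE hr0 hr1)), mul_zero]

theorem isMaximizer_iff_candidate (hεR : 0 ≤ W.εR) (hεE : 0 ≤ W.εE) (hP : 0 < W.P)
    (hR : W.εR < ‖W.hR‖) (hE : W.hE ≠ 0) (hr0 : 0 < W.r) (hr1 : W.r < 1) (z : ℝ) :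
    W.IsMaximizer z ↔
      ∃ x ∈ W.candidates, z = zOf x ∧ IsMaxOn (fun y => W.g (zOf y)) W.candidates x := by
  have hmem := fun x (hx : x ∈ W.candidates) => zOf_mem_Icc hr1 (z0_le_one hεR hR) hx.1
  constructor
  · intro hz
    obtain ⟨x, hx, rfl⟩ := hz.exists_candidate hεR hεE hP hR hE hr0 hr1
    exact ⟨x, hx, rfl, fun y hy => hz.2 (hmem y hy)⟩
  · rintro ⟨x, hx, rfl, hmax⟩
    obtain ⟨z, hz⟩ := exists_isMaximizer hεR hP hR hE
    obtain ⟨y, hy, rfl⟩ := hz.exists_candidate hεR hεE hP hR hE hr0 hr1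
    refine ⟨hmem x hx, fun z' hz' => ?_⟩
    exact (show W.g z' ≤ _ from hz.2 hz').trans (hmax hy)

end Sextic

/-! ### Optimality and the case of rate zero -/

section Optimality

variable {n : ℕ} {W : MISOWiretap n}

/-- When both conditions fail, `hR` is within `εR + εE` of the set of points `t hE`, `|t| ≤ 1`. -/
theorem worstCaseRate_nonpos_of_not_cond (hεR : 0 ≤ W.εR) (hεE : 0 ≤ W.εE) (hP : 0 < W.P)
    (hR : W.εR < ‖W.hR‖) (hE : W.hE ≠ 0) (h : ¬(W.cond1 ∨ W.cond2))
    {Q : Matrix (Fin n) (Fin n) ℂ} (hQ : Q.PosSemidef) : W.worstCaseRate Q ≤ 0 := by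
  have hRn : 0 < ‖W.hR‖ := hεR.trans_lt hR
  have hEn := norm_pos_iff.2 hE
  have hs2 := W.sq_sqrt_one_sub_r_sq
  rw [cond_iff hεR hεE (sqrt_b_div_a hP) (by positivity), not_or, not_and, not_and, not_lt,
    not_lt] at h
  obtain ⟨h1, h2⟩ := h
  obtain ⟨ω, hω, hωR⟩ : ∃ ω : ℂ, ‖ω‖ = 1 ∧
      inner ℂ W.hR (ω • W.hE) = ((W.r * (‖W.hR‖ * ‖W.hE‖) : ℝ) : ℂ) := by
    have hr : W.r * (‖W.hR‖ * ‖W.hE‖) = ‖inner ℂ W.hR W.hE‖ := by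
      rw [r, norm_inner_symm, div_mul_cancel₀ _ (by positivity)]
    rw [hr]
    rcases eq_or_ne (inner ℂ W.hR W.hE) (0 : ℂ) with h0 | h0
    · exact ⟨1, norm_one, by rw [one_smul, h0]; simp⟩
    · have h0' : (‖inner ℂ W.hR W.hE‖ : ℂ) ≠ 0 := by simpa using h0
      refine ⟨inner ℂ W.hE W.hR / ‖inner ℂ W.hR W.hE‖, ?_, ?_⟩
      · rw [norm_div, norm_inner_symm]
        simp [h0]
      · rw [inner_smul_right, div_mul_eq_mul_div, ← inner_conj_symm W.hE, Complex.conj_mul']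
        field_simp
  have hnorm : ∀ t : ℝ, ‖W.hR - t • ω • W.hE‖ ^ 2 =
      ‖W.hR‖ ^ 2 - 2 * t * (W.r * (‖W.hR‖ * ‖W.hE‖)) + t ^ 2 * ‖W.hE‖ ^ 2 := by
    intro t
    rw [@norm_sub_sq ℂ, inner_smul_right_eq_smul, hωR, norm_smul, norm_smul, hω, one_mul, mul_pow,
      Real.norm_eq_abs, sq_abs, Complex.real_smul, ← Complex.ofReal_mul]
    rw [show ∀ x : ℝ, RCLike.re (x : ℂ) = x from Complex.ofReal_re]
    ring
  have hsum : (W.c * (‖W.hR‖ / ‖W.hE‖) + W.d) * ‖W.hE‖ = W.εR + W.εE := by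
    rw [c, d]
    field_simp
  have hε : 0 ≤ W.εR + W.εE := add_nonneg hεR hεE
  rcases le_or_gt (W.r * (‖W.hR‖ / ‖W.hE‖)) 1 with hle | hlt
  · refine worstCaseRate_nonpos hεR hεE hω
      (mul_nonneg W.r_nonneg (div_nonneg (norm_nonneg _) (norm_nonneg _))) hle ?_ hQ
    have h3 := mul_le_mul_of_nonneg_right (h1 hle) hEn.le
    rw [hsum] at h3
    refine le_trans (le_of_eq ?_) h3
    refine (pow_left_inj₀ (norm_nonneg _) (by positivity) two_ne_zero).1 ?_
    rw [hnorm, mul_pow _ ‖W.hE‖, mul_pow _ √(1 - W.r ^ 2), hs2]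
    field_simp
    ring
  · refine worstCaseRate_nonpos hεR hεE hω zero_le_one le_rfl ?_ hQ
    have h3 := mul_le_mul_of_nonneg_right (h2 hlt) hEn.le
    rw [hsum] at h3
    refine le_trans (le_of_eq ?_) h3
    refine (pow_left_inj₀ (norm_nonneg _) (by positivity) two_ne_zero).1 ?_
    rw [hnorm, mul_pow, ← hs2, Real.sq_sqrt (by positivity), hs2]
    field_simp
    ring

theorem zero_mem_feasible (hP : 0 < W.P) : (0 : Matrix (Fin n) (Fin n) ℂ) ∈ W.feasible :=
  ⟨Matrix.PosSemidef.zero, by simpa using hP.le⟩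

theorem rankOneCov_mem_feasible (hP : 0 < W.P) {u : EuclideanSpace ℂ (Fin n)} (hu : ‖u‖ = 1) :
    rankOneCov W.P u ∈ W.feasible :=
  ⟨posSemidef_rankOneCov hP.le u, by rw [trace_rankOneCov, Complex.ofReal_re, hu]; simp⟩

theorem worstCaseRate_zero (hεR : 0 ≤ W.εR) (hεE : 0 ≤ W.εE) : W.worstCaseRate 0 = 0 := by
  obtain ⟨kR, -, kE, -, h⟩ := (isLeast_rateSet (W := W) hεR hεE Matrix.PosSemidef.zero).1
  rw [h]
  simp [secrecyRate, quadForm]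

theorem IsMaximizer.one_lt_g (hεR : 0 ≤ W.εR) (hεE : 0 ≤ W.εE) (hP : 0 < W.P)
    (hR : W.εR < ‖W.hR‖) (hE : W.hE ≠ 0) (h : W.cond1 ∨ W.cond2) {z : ℝ} (hz : W.IsMaximizer z) :
    1 < W.g z := by
  obtain ⟨z', hz', hg⟩ := exists_one_lt_g hεR hεE hP hR hE h
  exact hg.trans_le (hz.2 hz')

/-- The direction of a maximizer of `g` with a positive rate gives the optimal covariance. -/
theorem IsMaximizer.isGreatest (hεR : 0 ≤ W.εR) (hεE : 0 ≤ W.εE) (hP : 0 < W.P)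
    (hR : W.εR < ‖W.hR‖) (hE : W.hE ≠ 0) {z : ℝ} (hz : W.IsMaximizer z) (hg : 1 < W.g z) :
    IsGreatest (W.worstCaseRate '' W.feasible) (Real.log (W.g z)) := by
  obtain ⟨hu, -, hval, huniq⟩ := hz.certificate hεR hεE hP hR hE hg
  refine ⟨⟨_, rankOneCov_mem_feasible hP hu, hval⟩, ?_⟩
  rintro _ ⟨Q, hQ, rfl⟩
  by_contra! hlt
  rw [huniq Q hQ hlt.le, hval] at hlt
  exact lt_irrefl _ hlt

/-- Uniqueness of the maximizer of `g`, from uniqueness of the optimal covariance. -/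
theorem IsMaximizer.eq_of_one_lt_g (hεR : 0 ≤ W.εR) (hεE : 0 ≤ W.εE) (hP : 0 < W.P)
    (hR : W.εR < ‖W.hR‖) (hE : W.hE ≠ 0) {z z' : ℝ} (hz : W.IsMaximizer z)
    (hz' : W.IsMaximizer z') (hg : 1 < W.g z) : z' = z := by
  have hgg : W.g z' = W.g z := le_antisymm (hz.2 hz'.1) (hz'.2 hz.1)
  obtain ⟨-, hcorr, -, huniq⟩ := hz.certificate hεR hεE hP hR hE hg
  obtain ⟨hu', hcorr', hval', -⟩ := hz'.certificate hεR hεE hP hR hE (hg.trans_eq hgg.symm)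
  have hQ := huniq _ (rankOneCov_mem_feasible hP hu') (by rw [hval', hgg])
  -- the covariance determines the correlation with `hR`
  have h1 := congrArg (fun Q => quadForm Q W.hR) hQ
  simp only [quadForm_rankOneCov] at h1
  rw [hcorr, hcorr', mul_right_inj' hP.ne'] at h1
  have h0 : 0 ≤ z := W.z0_nonneg.trans hz.1.1
  have h0' : 0 ≤ z' := W.z0_nonneg.trans hz'.1.1
  exact mul_right_cancel₀ (hεR.trans_lt hR).ne'
    ((pow_left_inj₀ (by positivity) (by positivity) two_ne_zero).1 h1)

theorem IsMaximizer.isRankOneSolution (hεR : 0 ≤ W.εR) (hεE : 0 ≤ W.εE) (hP : 0 < W.P)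
    (hR : W.εR < ‖W.hR‖) (hE : W.hE ≠ 0) {z : ℝ} (hz : W.IsMaximizer z) (hg : 1 < W.g z) :
    W.IsRankOneSolution (W.uStar z) := by
  obtain ⟨hu, -, hval, -⟩ := hz.certificate hεR hεE hP hR hE hg
  refine ⟨hu, fun v hv => ?_⟩
  have h1 := (hz.isGreatest hεR hεE hP hR hE hg).2 ⟨_, rankOneCov_mem_feasible hP hv, rfl⟩
  obtain ⟨h2, h3⟩ := worstCaseRate_rankOneCov hεR hεE hP v
  obtain ⟨h4, h5⟩ := worstCaseRate_rankOneCov hεR hεE hP (W.uStar z)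
  rw [← hval, h2, h4] at h1
  exact (Real.log_le_log_iff h3 h5).1 h1

theorem IsMaximizer.isOptimalCov_iff (hεR : 0 ≤ W.εR) (hεE : 0 ≤ W.εE) (hP : 0 < W.P)
    (hR : W.εR < ‖W.hR‖) (hE : W.hE ≠ 0) {z : ℝ} (hz : W.IsMaximizer z) (hg : 1 < W.g z)
    (Q : Matrix (Fin n) (Fin n) ℂ) :
    W.IsOptimalCov Q ↔ Q = rankOneCov W.P (W.uStar z) := by
  obtain ⟨hu, -, hval, huniq⟩ := hz.certificate hεR hεE hP hR hE hg
  have hfeas := rankOneCov_mem_feasible hP hu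
  constructor
  · rintro ⟨hQ, hmax⟩
    exact huniq Q hQ (hval ▸ hmax hfeas)
  · rintro rfl
    refine ⟨hfeas, fun Q hQ => ?_⟩
    exact ((hz.isGreatest hεR hεE hP hR hE hg).2 ⟨Q, hQ, rfl⟩).trans_eq hval.symm

theorem isGreatest_zero_of_not_cond (hεR : 0 ≤ W.εR) (hεE : 0 ≤ W.εE) (hP : 0 < W.P)
    (hR : W.εR < ‖W.hR‖) (hE : W.hE ≠ 0) (h : ¬(W.cond1 ∨ W.cond2)) :
    IsGreatest (W.worstCaseRate '' W.feasible) 0 := by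
  refine ⟨⟨0, zero_mem_feasible hP, worstCaseRate_zero hεR hεE⟩, ?_⟩
  rintro _ ⟨Q, hQ, rfl⟩
  exact worstCaseRate_nonpos_of_not_cond hεR hεE hP hR hE h hQ.1

theorem cond_iff_of_power {P' : ℝ} (hP : 0 < W.P) (hP' : 0 < P') :
    (({ W with P := P' } : MISOWiretap n).cond1 ↔ W.cond1) ∧
      (({ W with P := P' } : MISOWiretap n).cond2 ↔ W.cond2) := by
  have h : √(({ W with P := P' } : MISOWiretap n).b / ({ W with P := P' } : MISOWiretap n).a) =
      √(W.b / W.a) := by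
    rw [sqrt_b_div_a hP, sqrt_b_div_a (W := { W with P := P' }) hP']
  unfold cond1 cond2
  rw [h]
  exact ⟨Iff.rfl, Iff.rfl⟩

end Optimality

end MISOWiretap

theorem theorem1 {n : ℕ} (W : MISOWiretap n) (hεR : 0 ≤ W.εR) (hεE : 0 ≤ W.εE) (hP : 0 < W.P)
    (hR : W.εR < ‖W.hR‖) (hE : W.hE ≠ 0) :
    -- all minima and maxima in the two optimization problems are attained
    ((∀ Q ∈ W.feasible, IsLeast (W.rateSet Q) (W.worstCaseRate Q)) ∧
      IsGreatest (W.worstCaseRate '' W.feasible) W.maxRate ∧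
      (∀ u : EuclideanSpace ℂ (Fin n), IsLeast (W.gainR u) (sInf (W.gainR u)) ∧
        IsGreatest (W.gainE u) (sSup (W.gainE u)))) ∧
    -- (i) the condition for a positive rate, and its independence of the power
    (0 < W.maxRate ↔ W.cond1 ∨ W.cond2) ∧
    (∀ P' : ℝ, 0 < P' →
      (({ W with P := P' } : MISOWiretap n).cond1 ↔ W.cond1) ∧
      (({ W with P := P' } : MISOWiretap n).cond2 ↔ W.cond2)) ∧
    -- (ii) the optimal covariance and the maximum rate
    (W.cond1 ∨ W.cond2 →
      (∃! z : ℝ, W.IsMaximizer z) ∧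
      ∀ z : ℝ, W.IsMaximizer z →
        W.IsRankOneSolution (W.uStar z) ∧
        (∀ Q : Matrix (Fin n) (Fin n) ℂ,
          W.IsOptimalCov Q ↔ Q = MISOWiretap.rankOneCov W.P (W.uStar z)) ∧
        (MISOWiretap.rankOneCov W.P (W.uStar z)).rank = 1 ∧
        W.maxRate = Real.log (W.g z)) ∧
    -- the determination of the maximizer
    (0 < W.r → W.r < 1 →
      W.sextic.natDegree = 6 ∧
      (W.sextic.map (algebraMap ℝ ℂ)).roots = W.GC.charpoly.roots ∧
      (∀ l : ℂ, Module.End.HasEigenvalue (Matrix.toLin' W.GC) l ↔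
        Polynomial.aeval l W.sextic = 0) ∧
      (∀ z : ℝ, W.IsMaximizer z ↔
        ∃ x ∈ W.candidates, z = MISOWiretap.zOf x ∧
          IsMaxOn (fun y => W.g (MISOWiretap.zOf y)) W.candidates x)) := by
  have hmax := fun z (hz : W.IsMaximizer z) (h : W.cond1 ∨ W.cond2) =>
    hz.isGreatest hεR hεE hP hR hE (hz.one_lt_g hεR hεE hP hR hE h)
  refine ⟨⟨fun Q hQ => MISOWiretap.isLeast_rateSet hεR hεE hQ.1, ?_, fun u =>
    ⟨MISOWiretap.isLeast_gainR hεR u, MISOWiretap.isGreatest_gainE hεE u⟩⟩, ?_,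
    fun P' hP' => MISOWiretap.cond_iff_of_power hP hP', ?_, ?_⟩
  · by_cases h : W.cond1 ∨ W.cond2
    · obtain ⟨z, hz⟩ := MISOWiretap.exists_isMaximizer hεR hP hR hE
      have := hmax z hz h
      rwa [MISOWiretap.maxRate, this.csSup_eq]
    · have := MISOWiretap.isGreatest_zero_of_not_cond hεR hεE hP hR hE h
      rwa [MISOWiretap.maxRate, this.csSup_eq]
  · constructor
    · intro hpos
      by_contra h
      rw [MISOWiretap.maxRate,
        (MISOWiretap.isGreatest_zero_of_not_cond hεR hεE hP hR hE h).csSup_eq] at hpos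
      exact lt_irrefl _ hpos
    · intro h
      obtain ⟨z, hz⟩ := MISOWiretap.exists_isMaximizer hεR hP hR hE
      rw [MISOWiretap.maxRate, (hmax z hz h).csSup_eq]
      exact Real.log_pos (hz.one_lt_g hεR hεE hP hR hE h)
  · intro h
    obtain ⟨z₀, hz₀⟩ := MISOWiretap.exists_isMaximizer hεR hP hR hE
    refine ⟨⟨z₀, hz₀, fun z hz =>
      hz₀.eq_of_one_lt_g hεR hεE hP hR hE hz (hz₀.one_lt_g hεR hεE hP hR hE h)⟩, fun z hz => ?_⟩
    have hg := hz.one_lt_g hεR hεE hP hR hE h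
    refine ⟨hz.isRankOneSolution hεR hεE hP hR hE hg, hz.isOptimalCov_iff hεR hεE hP hR hE hg,
      MISOWiretap.rank_rankOneCov hP.ne' ?_, (hmax z hz h).csSup_eq⟩
    rw [← norm_ne_zero_iff, (hz.certificate hεR hεE hP hR hE hg).1]
    exact one_ne_zero
  · intro hr0 hr1
    have ha0 := MISOWiretap.a0_ne_zero hεR hεE hP hR hE hr0 hr1
    refine ⟨MISOWiretap.natDegree_sextic ha0, ?_, MISOWiretap.hasEigenvalue_GC_iff ha0,
      MISOWiretap.isMaximizer_iff_candidate hεR hεE hP hR hE hr0 hr1⟩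
    rw [MISOWiretap.map_sextic_eq ha0, Polynomial.roots_C_mul _ (by exact_mod_cast ha0)]
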